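/- Let $(X,\mu)$ be a $\sigma$-finite measure space, $V$ a separable complex Hilbert space, $A$ a (possibly unbounded) self-adjoint operator on $\mathcal H=L^2(X,\mu;V)$, and $\Omega\subset X$ a measurable set. For $t\in\mathbb R$ let $\Pi_t=\mathbf 1_{]-\infty,t[}(A)$ be the spectral projections of $A$, let $\chi_\Omega$ be multiplication by the indicator function of $\Omega$, and set $$F_\Omega(t)=\tau(\Pi_t\chi_\Omega\Pi_t)\in[0,+\infty],\qquad F_\Omega^{-1}(u)=\sup\{x\in\mathbb R: F_\Omega(x)\le u\}\in[-\infty,+\infty],\qquad \varphi_\Omega(y)=\int_0^yF_\Omega^{-1}(u)\,du ,$$ where $\tau$ is the trace and $y\in[0,+\infty]$. For $f\in\mathcal H$ put $\mathcal E^{\pm}(f)=\int_{\mathbb R}\max(\pm t,0)\,d\langle\Pi_tf,f\rangle\in[0,+\infty]$, and, if $\mathcal E^+(f)<\infty$, $\mathcal E(f)=\mathcal E^+(f)-\mathcal E^-(f)=\int_{\mathbb R} t\,d\langle\Pi_tf,f\rangle\in[-\infty,+\infty[$. For $\lambda\in\mathbb R$ let $$N_\Omega(\lambda)=\sup\{\dim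 L : L\subset\mathcal H \text{ a linear subspace of functions vanishing a.e. outside }\Omega,\ \mathcal E^+(f)<\infty \text{ and } \mathcal E(f)\le\lambda\|f\|^2 \text{ for all } f\in L\}\in\mathbb N\cup\{+\infty\}$$ be the Dirichlet spectral counting function of $A$ in $\Omega$. Then, for every $\lambda\in\mathbb R$, the integral defining $\varphi_\Omega(y)$ has a finite positive part for every finite $y\in[0,N_\Omega(\lambda)]$, and $$\varphi_\Omega(N_\Omega(\lambda))\le\lambda\,N_\Omega(\lambda)$$ (with the conventions $0\cdot\infty=0$, and $\varphi_\Omega(\infty)=-\infty$ if the positive and the negative part of the integral over $]0,\infty[$ are both infinite). If moreover $A$ is positive, that is $\langle f,Af\rangle\ge0$ for all $f$ in the domain of $A$, then $$N_\Omega(\lambda)\le 2F_\Omega(2\lambda)\qquad\text{for every real }\lambda\ne0 .$$ -/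

import Mathlib

open MeasureTheory Filter Topology
open scoped ENNReal InnerProductSpace

noncomputable section

namespace DirichletCounting

/-! ### Spectral families and spectral projections of self-adjoint operators -/

/-- A (left continuous) spectral family, also called a resolution of the identity, on a complex
Hilbert space: `proj t` plays the role of the projection on the spectral interval `]-∞, t[`. -/
structure SpectralFamily (H : Type*) [NormedAddCommGroup H] [InnerProductSpace ℂ H]
    [CompleteSpace H] where
  proj : ℝ → (H →L[ℂ] H)
  isProj : ∀ t, IsStarProjection (proj t)
  proj_mul : ∀ s t, s ≤ t → proj s * proj t = proj s
  left_cont : ∀ (f : H) (t : ℝ), Tendsto (fun s => proj s f) (𝓝[<] t) (𝓝 (proj t f))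
  tendsto_bot : ∀ f : H, Tendsto (fun s => proj s f) atBot (𝓝 0)
  tendsto_top : ∀ f : H, Tendsto (fun s => proj s f) atTop (𝓝 f)

namespace SpectralFamily

variable {H : Type*} [NormedAddCommGroup H] [InnerProductSpace ℂ H] [CompleteSpace H]

theorem norm_proj_le (E : SpectralFamily H) (t : ℝ) (f : H) : ‖E.proj t f‖ ≤ ‖f‖ := by
  have h := (E.isProj t).norm_le
  calc ‖E.proj t f‖ ≤ ‖E.proj t‖ * ‖f‖ := (E.proj t).le_opNorm f
    _ ≤ 1 * ‖f‖ := by gcongr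
    _ = ‖f‖ := one_mul _

theorem monotone_normSq (E : SpectralFamily H) (f : H) :
    Monotone fun t : ℝ => ‖E.proj t f‖ ^ 2 := by
  intro s t hst
  have h : E.proj s f = E.proj s (E.proj t f) := by
    conv_lhs => rw [← E.proj_mul s t hst]
    rfl
  have h2 : ‖E.proj s f‖ ≤ ‖E.proj t f‖ := by
    rw [h]
    exact E.norm_proj_le s _
  show ‖E.proj s f‖ ^ 2 ≤ ‖E.proj t f‖ ^ 2
  gcongr

/-- The scalar spectral measure `d⟨E_t f, f⟩ = d‖E_t f‖²`, a Borel measure on `ℝ` defined as a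
Lebesgue--Stieltjes measure. -/
def scalarMeasure (E : SpectralFamily H) (f : H) : Measure ℝ :=
  (E.monotone_normSq f).stieltjesFunction.measure

/-- `E` is the spectral resolution of `A`, that is `A = ∫ t dE_t`: the domain of `A` is the set of
all `f` with `∫ t² d⟨E_t f, f⟩ < ∞`, and `⟨f, A f⟩ = ∫ t d⟨E_t f, f⟩` for these `f`. -/
structure IsResolutionOf (E : SpectralFamily H) (A : H →ₗ.[ℂ] H) : Prop where
  mem_domain_iff : ∀ f : H,
    f ∈ A.domain ↔ ∫⁻ t, ENNReal.ofReal (t ^ 2) ∂(E.scalarMeasure f) < ⊤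
  inner_apply : ∀ f : A.domain,
    ⟪(f : H), A f⟫_ℂ = ((∫ t, t ∂(E.scalarMeasure (f : H)) : ℝ) : ℂ)

/-- The spectral family of the zero operator. -/
instance : Nonempty (SpectralFamily H) :=
  ⟨{ proj := fun t => if t ≤ 0 then 0 else 1
     isProj := by
      intro t
      show IsStarProjection (if t ≤ 0 then (0 : H →L[ℂ] H) else 1)
      split_ifs
      · exact IsStarProjection.zero _
      · exact IsStarProjection.one _
     proj_mul := by
      intro s t hst
      show (if s ≤ 0 then (0 : H →L[ℂ] H) else 1) * (if t ≤ 0 then (0 : H →L[ℂ] H) else 1) = _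
      by_cases hs : s ≤ 0
      · simp [hs]
      · have ht : ¬ t ≤ 0 := fun h => hs (hst.trans h)
        simp [hs, ht]
     left_cont := by
      intro f t
      by_cases ht : t ≤ 0
      · refine tendsto_const_nhds.congr' ?_
        filter_upwards [self_mem_nhdsWithin] with s hs
        have hs' : s ≤ 0 := (le_of_lt hs).trans ht
        simp [hs', ht]
      · refine tendsto_const_nhds.congr' ?_
        filter_upwards [nhdsWithin_le_nhds (Ioi_mem_nhds (not_le.mp ht))] with s hs
        have hs' : ¬ s ≤ 0 := not_le.mpr hs
        simp [hs', ht]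
     tendsto_bot := by
      intro f
      refine tendsto_const_nhds.congr' ?_
      filter_upwards [eventually_le_atBot (0 : ℝ)] with s hs
      simp [hs]
     tendsto_top := by
      intro f
      refine tendsto_const_nhds.congr' ?_
      filter_upwards [eventually_gt_atTop (0 : ℝ)] with s hs
      simp [not_le.mpr hs] }⟩

end SpectralFamily

/-- The spectral family `Π_t = 1_{]-∞, t[}(A)` of an unbounded self-adjoint operator `A`, that is
the one spectral family with `A = ∫ t dΠ_t` (unique and existing by the spectral theorem). -/
def spectralFamily {H : Type*} [NormedAddCommGroup H] [InnerProductSpace ℂ H] [CompleteSpace H]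
    (A : H →ₗ.[ℂ] H) : SpectralFamily H :=
  Classical.epsilon fun E : SpectralFamily H => E.IsResolutionOf A

/-- The positive part `𝓔⁺(f) = ‖max(A,0)^{1/2} f‖² = ∫ max(t,0) d⟨Π_t f, f⟩` of the energy. -/
def energyPos {H : Type*} [NormedAddCommGroup H] [InnerProductSpace ℂ H] [CompleteSpace H]
    (A : H →ₗ.[ℂ] H) (f : H) : ℝ≥0∞ :=
  ∫⁻ t, ENNReal.ofReal t ∂((spectralFamily A).scalarMeasure f)

/-- The negative part `𝓔⁻(f) = ∫ max(-t,0) d⟨Π_t f, f⟩` of the energy. -/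
def energyNeg {H : Type*} [NormedAddCommGroup H] [InnerProductSpace ℂ H] [CompleteSpace H]
    (A : H →ₗ.[ℂ] H) (f : H) : ℝ≥0∞ :=
  ∫⁻ t, ENNReal.ofReal (-t) ∂((spectralFamily A).scalarMeasure f)

/-- The energy (quadratic form) `𝓔(f) = ∫ t d⟨Π_t f, f⟩` of `A`; it is meaningful, with values in
`[-∞, +∞[`, when `𝓔⁺(f)` is finite. -/
def energy {H : Type*} [NormedAddCommGroup H] [InnerProductSpace ℂ H] [CompleteSpace H]
    (A : H →ₗ.[ℂ] H) (f : H) : EReal :=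
  (energyPos A f : EReal) - (energyNeg A f : EReal)

/-- `A` is positive: `⟨f, A f⟩ ≥ 0` on the domain of `A`. -/
def IsPositiveOp {H : Type*} [NormedAddCommGroup H] [InnerProductSpace ℂ H]
    (A : H →ₗ.[ℂ] H) : Prop :=
  ∀ f : A.domain, 0 ≤ (⟪(f : H), A f⟫_ℂ).re

/-- The trace in `[0, +∞]` of a positive bounded operator `T`: the sum of `⟨e_i, T e_i⟩` over a
Hilbert basis `(e_i)` (for positive `T` it does not depend on the basis). -/
def posTrace {H : Type*} [NormedAddCommGroup H] [InnerProductSpace ℂ H] [CompleteSpace H]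
    (T : H →L[ℂ] H) : ℝ≥0∞ :=
  ∑' i : (exists_hilbertBasis ℂ H).choose, ENNReal.ofReal (⟪(i : H), T (i : H)⟫_ℂ).re

/-! ### The space `L²(X, V)` -/

section Space

variable {X : Type*} [MeasurableSpace X] {μ : Measure X}
  {V : Type*} [NormedAddCommGroup V] [InnerProductSpace ℂ V]

/-- Multiplication by the indicator function `χ_Ω` on `L²(X, V)`. -/
def mulIndicator (μ : Measure X) (V : Type*) [NormedAddCommGroup V] [InnerProductSpace ℂ V]
    {Ω : Set X} (hΩ : MeasurableSet Ω) : Lp V 2 μ →L[ℂ] Lp V 2 μ :=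
  LinearMap.mkContinuous
    { toFun := fun f => ((Lp.memLp f).indicator hΩ).toLp (Ω.indicator f)
      map_add' := by
        intro f g
        rw [← MemLp.toLp_add]
        refine MemLp.toLp_congr _ _ ?_
        filter_upwards [Lp.coeFn_add f g] with x hx
        by_cases h : x ∈ Ω
        · simpa only [Set.indicator_of_mem h, Pi.add_apply] using hx
        · simp only [Set.indicator_of_notMem h, Pi.add_apply, add_zero]
      map_smul' := by
        intro c f
        rw [RingHom.id_apply, ← MemLp.toLp_const_smul]
        refine MemLp.toLp_congr _ _ ?_
        filter_upwards [Lp.coeFn_smul c f] with x hx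
        by_cases h : x ∈ Ω
        · simpa only [Set.indicator_of_mem h, Pi.smul_apply] using hx
        · simp only [Set.indicator_of_notMem h, Pi.smul_apply, smul_zero] }
    1 (by
      intro f
      rw [one_mul]
      refine Lp.norm_le_norm_of_ae_le ?_
      filter_upwards [((Lp.memLp f).indicator hΩ).coeFn_toLp] with x hx
      show ‖(((Lp.memLp f).indicator hΩ).toLp (Ω.indicator f)) x‖ ≤ ‖f x‖
      rw [hx]
      exact norm_indicator_le_norm_self _ _)

theorem mulIndicator_ae (μ : Measure X) (V : Type*) [NormedAddCommGroup V]
    [InnerProductSpace ℂ V] {Ω : Set X} (hΩ : MeasurableSet Ω) (f : Lp V 2 μ) :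
    mulIndicator μ V hΩ f =ᵐ[μ] Ω.indicator f :=
  ((Lp.memLp f).indicator hΩ).coeFn_toLp

/-- All elements of the linear space `L` of functions are supported in `Ω`. -/
def SupportedIn (L : Submodule ℂ (Lp V 2 μ)) (Ω : Set X) : Prop :=
  ∀ f ∈ L, ∀ᵐ x ∂μ, x ∉ Ω → (f : X → V) x = 0

variable [CompleteSpace V]

/-- The spectral measure `F_Ω(t) = τ(Π_t χ_Ω Π_t)` of the set `Ω`. -/
def specMeasure (A : Lp V 2 μ →ₗ.[ℂ] Lp V 2 μ) {Ω : Set X} (hΩ : MeasurableSet Ω) (t : ℝ) :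
    ℝ≥0∞ :=
  posTrace ((spectralFamily A).proj t * mulIndicator μ V hΩ * (spectralFamily A).proj t)

/-- The energy is at most `lam` on `L`, that is `𝓔⁺(f) < ∞` and `𝓔(f) ≤ lam ‖f‖²` for all `f`
in `L`. -/
def EnergyLEOn (A : Lp V 2 μ →ₗ.[ℂ] Lp V 2 μ) (lam : ℝ) (L : Submodule ℂ (Lp V 2 μ)) : Prop :=
  ∀ f ∈ L, energyPos A f < ⊤ ∧ energy A f ≤ ((lam * ‖f‖ ^ 2 : ℝ) : EReal)

/-- The Dirichlet spectral counting function `N_Ω(lam)`: the supremum, in `ℕ ∪ {∞}`, of the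
dimensions of the linear spaces of functions supported in `Ω` on which the energy is at most
`lam`. -/
def dirichletCount (A : Lp V 2 μ →ₗ.[ℂ] Lp V 2 μ) (Ω : Set X) (lam : ℝ) : ℕ∞ :=
  ⨆ (L : Submodule ℂ (Lp V 2 μ)) (_ : SupportedIn L Ω ∧ EnergyLEOn A lam L),
    Cardinal.toENat (Module.rank ℂ L)

end Space

/-! ### Pseudo-inverses and their integrals -/

/-- The pseudo-inverse `F⁻¹(u) = sup {x ∈ ℝ | F(x) ≤ u} ∈ [-∞, +∞]`. -/
def pseudoInv (F : ℝ → ℝ≥0∞) (u : ℝ) : EReal :=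
  sSup ((fun x : ℝ => (x : EReal)) '' {x : ℝ | F x ≤ ENNReal.ofReal u})

/-- The integral `∫_0^y max(F⁻¹(u), 0) du`, for `y ∈ [0, +∞]`. -/
def phiPos (F : ℝ → ℝ≥0∞) (y : ℝ≥0∞) : ℝ≥0∞ :=
  ∫⁻ u in {u : ℝ | 0 < u ∧ ENNReal.ofReal u < y}, (pseudoInv F u).toENNReal

/-- The integral `∫_0^y max(-F⁻¹(u), 0) du`, for `y ∈ [0, +∞]`. -/
def phiNeg (F : ℝ → ℝ≥0∞) (y : ℝ≥0∞) : ℝ≥0∞ :=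
  ∫⁻ u in {u : ℝ | 0 < u ∧ ENNReal.ofReal u < y}, (-pseudoInv F u).toENNReal

/-- `φ(y) = ∫_0^y F⁻¹(u) du ∈ [-∞, +∞]`, as the difference of the integrals of the positive and the
negative part of `F⁻¹` (and `∞ - ∞ = -∞`, the convention of `EReal`). -/
def phi (F : ℝ → ℝ≥0∞) (y : ℝ≥0∞) : EReal :=
  (phiPos F y : EReal) - (phiNeg F y : EReal)

end DirichletCounting

end

noncomputable section

namespace DirichletCounting

open scoped CompactlySupported

/-! ### Scalar spectral measures of a spectral family -/

section Scalar
variable {H : Type*} [NormedAddCommGroup H] [InnerProductSpace ℂ H] [CompleteSpace H]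

namespace SpectralFamily

/-! Take `n ≤ N_Ω(λ)` and an orthonormal system `e_1, …, e_n` of functions supported in `Ω` with
energies at most `λ`. The sum `ν` of their scalar spectral measures has mass `n`, and `ν(]-∞, t[) =
∑ ‖Π_t e_k‖²` is part of the squared Hilbert–Schmidt norm of `Π_t χ_Ω`, hence at most `F_Ω(t)`
(`sum_enorm_sq_le_posTrace`). So the quantile function of `ν` dominates `F_Ω⁻¹` on `]0, n[`, and
integrating gives `φ_Ω(n) ≤ ∫ t dν = ∑ 𝓔(e_k) ≤ λ n`. Infinite values are possible, so positive and
negative parts are compared separately by the layer cake formula (`phiPos_le_lintegral`,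
`lintegral_le_phiNeg`); `N_Ω(λ) = ∞` is reached through all finite `n`.

For positive `A`, Chebyshev's inequality puts at least half of the mass of each `e_k` below `2λ`, so
`n/2 ≤ ν(]-∞, 2λ[) ≤ F_Ω(2λ)`. This needs spectral measures carried by `[0, ∞[`, hence a spectral
family that really resolves `A`. Since `spectralFamily` is a choice, its defining property follows
from existence (`exists_isResolutionOf`): the bounded resolvent `T = (A + 1)⁻¹` has scalar measures
by Riesz–Markov and spectral projections from the functional calculus, and `x ↦ x⁻¹ - 1` carries
them to `A`. -/

theorem tendsto_stieltjes_atBot (E : SpectralFamily H) (f : H) :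
    Tendsto (E.monotone_normSq f).stieltjesFunction atBot (𝓝 0) := by
  have h : Tendsto (fun t : ℝ => ‖E.proj t f‖ ^ 2) atBot (𝓝 0) := by
    simpa using ((E.tendsto_bot f).norm.pow 2)
  have h1 : Tendsto (fun t : ℝ => ‖E.proj (t + 1) f‖ ^ 2) atBot (𝓝 0) :=
    h.comp (tendsto_atBot_add_const_right atBot (1 : ℝ) tendsto_id)
  refine tendsto_of_tendsto_of_tendsto_of_le_of_le h h1 (fun t => ?_) fun t => ?_
  · exact (E.monotone_normSq f).le_rightLim le_rfl
  · exact (E.monotone_normSq f).rightLim_le (lt_add_one t)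

theorem tendsto_stieltjes_atTop (E : SpectralFamily H) (f : H) :
    Tendsto (E.monotone_normSq f).stieltjesFunction atTop (𝓝 (‖f‖ ^ 2)) := by
  have h : Tendsto (fun t : ℝ => ‖E.proj t f‖ ^ 2) atTop (𝓝 (‖f‖ ^ 2)) :=
    (E.tendsto_top f).norm.pow 2
  refine tendsto_of_tendsto_of_tendsto_of_le_of_le h tendsto_const_nhds (fun t => ?_) fun t => ?_
  · exact (E.monotone_normSq f).le_rightLim le_rfl
  · refine ((E.monotone_normSq f).rightLim_le (lt_add_one t)).trans ?_
    show ‖E.proj (t + 1) f‖ ^ 2 ≤ ‖f‖ ^ 2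
    gcongr
    exact E.norm_proj_le _ _

/-- The Stieltjes function is the right limit of `‖E_t f‖²`; its left limit at `t` recovers the
original value because the family is left continuous. -/
theorem scalarMeasure_Iio (E : SpectralFamily H) (f : H) (t : ℝ) :
    E.scalarMeasure f (Set.Iio t) = ENNReal.ofReal (‖E.proj t f‖ ^ 2) := by
  rw [scalarMeasure, StieltjesFunction.measure_Iio _ (E.tendsto_stieltjes_atBot f), sub_zero]
  congr 1
  have h1 : Tendsto (E.monotone_normSq f).stieltjesFunction (𝓝[<] t)
      (𝓝 (Function.leftLim (E.monotone_normSq f).stieltjesFunction t)) :=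
    (E.monotone_normSq f).stieltjesFunction.mono.tendsto_leftLim t
  have h : Tendsto (fun s : ℝ => ‖E.proj s f‖ ^ 2) (𝓝[<] t) (𝓝 (‖E.proj t f‖ ^ 2)) :=
    (E.left_cont f t).norm.pow 2
  refine tendsto_nhds_unique h1 ?_
  refine tendsto_of_tendsto_of_tendsto_of_le_of_le' h tendsto_const_nhds
    (Eventually.of_forall fun s => ?_) ?_
  · exact (E.monotone_normSq f).le_rightLim le_rfl
  · filter_upwards [self_mem_nhdsWithin] with s hs
    exact (E.monotone_normSq f).rightLim_le hs

theorem scalarMeasure_univ (E : SpectralFamily H) (f : H) :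
    E.scalarMeasure f Set.univ = ENNReal.ofReal (‖f‖ ^ 2) := by
  rw [scalarMeasure, StieltjesFunction.measure_univ _ (E.tendsto_stieltjes_atBot f)
    (E.tendsto_stieltjes_atTop f), sub_zero]

instance isFiniteMeasure_scalarMeasure (E : SpectralFamily H) (f : H) :
    IsFiniteMeasure (E.scalarMeasure f) :=
  ⟨by rw [scalarMeasure_univ]; exact ENNReal.ofReal_lt_top⟩

end SpectralFamily

/-! ### Hilbert--Schmidt sums -/

omit [CompleteSpace H] in
theorem tsum_enorm_sq_inner (x : H) {ι : Type*} (b : HilbertBasis ι ℂ H) :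
    ∑' i, ‖⟪b i, x⟫_ℂ‖ₑ ^ 2 = ‖x‖ₑ ^ 2 := by
  have h := b.hasSum_inner_mul_inner x x
  have h2 : HasSum (fun i => ‖⟪b i, x⟫_ℂ‖ ^ 2) (‖x‖ ^ 2) := by
    have h3 := Complex.reCLM.hasSum h
    convert h3 using 1
    · funext i
      show _ = (⟪x, b i⟫_ℂ * ⟪b i, x⟫_ℂ).re
      rw [← inner_conj_symm x, RCLike.conj_mul]
      norm_cast
    · show _ = (⟪x, x⟫_ℂ).re
      rw [inner_self_eq_norm_sq_to_K]
      norm_cast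
  have h4 : ∀ y : ℂ, ‖y‖ₑ ^ 2 = ENNReal.ofReal (‖y‖ ^ 2) := fun y => by
    rw [ENNReal.ofReal_pow (norm_nonneg _), ofReal_norm]
  simp_rw [h4]
  rw [← ENNReal.ofReal_tsum_of_nonneg (fun _ => by positivity) h2.summable, h2.tsum_eq,
    ENNReal.ofReal_pow (norm_nonneg _), ofReal_norm]

omit [CompleteSpace H] in
theorem tsum_enorm_sq_inner_le {κ : Type*} {e : κ → H} (he : Orthonormal ℂ e) (x : H) :
    ∑' k, ‖⟪e k, x⟫_ℂ‖ₑ ^ 2 ≤ ‖x‖ₑ ^ 2 := by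
  have h4 : ∀ y : ℂ, ‖y‖ₑ ^ 2 = ENNReal.ofReal (‖y‖ ^ 2) := fun y => by
    rw [ENNReal.ofReal_pow (norm_nonneg _), ofReal_norm]
  simp_rw [h4]
  rw [← ENNReal.ofReal_tsum_of_nonneg (fun _ => by positivity) (he.inner_products_summable x),
    ← ofReal_norm, ← ENNReal.ofReal_pow (norm_nonneg _)]
  exact ENNReal.ofReal_le_ofReal (he.tsum_inner_products_le x)

/-- Parseval on the left, Bessel on the right, with the double sum exchanged in between. Applied to
two bases it also gives the equality of the Hilbert–Schmidt norms of `T` and its adjoint. -/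
theorem tsum_enorm_sq_adjoint_le {ι κ : Type*} (b : HilbertBasis ι ℂ H) {e : κ → H}
    (he : Orthonormal ℂ e) (T : H →L[ℂ] H) :
    ∑' k, ‖ContinuousLinearMap.adjoint T (e k)‖ₑ ^ 2 ≤ ∑' i, ‖T (b i)‖ₑ ^ 2 := by
  calc ∑' k, ‖ContinuousLinearMap.adjoint T (e k)‖ₑ ^ 2
      = ∑' k, ∑' i, ‖⟪e k, T (b i)⟫_ℂ‖ₑ ^ 2 := by
        refine tsum_congr fun k => ?_
        rw [← tsum_enorm_sq_inner _ b]
        refine tsum_congr fun i => ?_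
        rw [ContinuousLinearMap.adjoint_inner_right, ← ofReal_norm, ← ofReal_norm, norm_inner_symm]
    _ = ∑' i, ∑' k, ‖⟪e k, T (b i)⟫_ℂ‖ₑ ^ 2 := ENNReal.tsum_comm
    _ ≤ ∑' i, ‖T (b i)‖ₑ ^ 2 := ENNReal.tsum_le_tsum fun i => tsum_enorm_sq_inner_le he _

/-- The Hilbert basis underlying `posTrace`. -/
theorem exists_posTrace_basis (H : Type*) [NormedAddCommGroup H] [InnerProductSpace ℂ H]
    [CompleteSpace H] : ∃ (ι : Set H) (b : HilbertBasis ι ℂ H), ∀ T : H →L[ℂ] H,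
      posTrace T = ∑' i, ENNReal.ofReal (⟪b i, T (b i)⟫_ℂ).re := by
  obtain ⟨b, hb⟩ := (exists_hilbertBasis ℂ H).choose_spec
  refine ⟨_, b, fun T => ?_⟩
  rw [posTrace]
  simp_rw [hb]

/-- `P M P = (M P)* (M P)`, so `posTrace (P * M * P)` is a squared Hilbert–Schmidt norm. -/
theorem re_inner_conj_proj {P M : H →L[ℂ] H} (hP : IsStarProjection P) (hM : IsStarProjection M)
    (x : H) : ENNReal.ofReal (⟪x, (P * M * P) x⟫_ℂ).re = ‖(M * P) x‖ₑ ^ 2 := by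
  have hP' : ContinuousLinearMap.adjoint P = P := hP.isSelfAdjoint
  have hM' : ContinuousLinearMap.adjoint M = M := hM.isSelfAdjoint
  have hM2 : M (M (P x)) = M (P x) := by
    conv_rhs => rw [← hM.isIdempotentElem.eq]
    rfl
  have h : ⟪x, (P * M * P) x⟫_ℂ = ⟪M (P x), M (P x)⟫_ℂ := by
    show ⟪x, P (M (P x))⟫_ℂ = _
    rw [← ContinuousLinearMap.adjoint_inner_left, hP', ← hM2,
      ← ContinuousLinearMap.adjoint_inner_left, hM', hM2]
  rw [h, inner_self_eq_norm_sq_to_K]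
  show ENNReal.ofReal (((‖M (P x)‖ : ℂ)) ^ 2).re = ‖M (P x)‖ₑ ^ 2
  rw [← Complex.ofReal_pow, Complex.ofReal_re, ENNReal.ofReal_pow (norm_nonneg _), ofReal_norm]

/-- As `M` fixes `e k`, the vector `P (e k)` is `(M P)* (e k)`, and the adjoint bound applies. -/
theorem sum_enorm_sq_le_posTrace {κ : Type*} {P M : H →L[ℂ] H} (hP : IsStarProjection P)
    (hM : IsStarProjection M) {e : κ → H} (he : Orthonormal ℂ e) (hMe : ∀ k, M (e k) = e k) :
    ∑' k, ‖P (e k)‖ₑ ^ 2 ≤ posTrace (P * M * P) := by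
  obtain ⟨ι, b, hb⟩ := exists_posTrace_basis H
  rw [hb]
  simp_rw [re_inner_conj_proj hP hM]
  refine le_trans (le_of_eq ?_) (tsum_enorm_sq_adjoint_le b he (M * P))
  have hP' : star P = P := hP.isSelfAdjoint
  have hM' : star M = M := hM.isSelfAdjoint
  have : ContinuousLinearMap.adjoint (M * P) = P * M := by
    rw [← ContinuousLinearMap.star_eq_adjoint, star_mul, hP', hM']
  refine tsum_congr fun k => ?_
  rw [this, mul_apply_eq_comp, hMe]

/-- `M E_t` and `E_t M` have the same Hilbert–Schmidt norm, and the latter grows with `t` term by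
term. -/
theorem posTrace_conj_mono (E : SpectralFamily H) {M : H →L[ℂ] H} (hM : IsStarProjection M) :
    Monotone fun t => posTrace (E.proj t * M * E.proj t) := by
  intro s t hst
  obtain ⟨ι, b, hb⟩ := exists_posTrace_basis H
  have hs : ∀ t, star (E.proj t) = E.proj t := fun t => (E.isProj t).isSelfAdjoint
  have hM' : star M = M := hM.isSelfAdjoint
  simp only [hb]
  simp_rw [re_inner_conj_proj (E.isProj _) hM]
  have h1 : ∀ t, ContinuousLinearMap.adjoint (E.proj t * M) = M * E.proj t := fun t => by
    rw [← ContinuousLinearMap.star_eq_adjoint, star_mul, hs, hM']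
  have h2 : ∀ t, ContinuousLinearMap.adjoint (M * E.proj t) = E.proj t * M := fun t => by
    rw [← ContinuousLinearMap.star_eq_adjoint, star_mul, hs, hM']
  calc _ ≤ ∑' i, ‖(E.proj s * M) (b i)‖ₑ ^ 2 := by
        simpa only [h1] using tsum_enorm_sq_adjoint_le b b.orthonormal (E.proj s * M)
    _ ≤ ∑' i, ‖(E.proj t * M) (b i)‖ₑ ^ 2 := by
        refine ENNReal.tsum_le_tsum fun i => ?_
        have h := E.monotone_normSq (M (b i)) hst
        have h' : ‖E.proj s (M (b i))‖ ≤ ‖E.proj t (M (b i))‖ :=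
          le_of_sq_le_sq h (norm_nonneg _)
        show ‖E.proj s (M (b i))‖ₑ ^ 2 ≤ ‖E.proj t (M (b i))‖ₑ ^ 2
        gcongr
        rw [← ofReal_norm, ← ofReal_norm]
        exact ENNReal.ofReal_le_ofReal h'
    _ ≤ _ := by
        simpa only [h2] using tsum_enorm_sq_adjoint_le b b.orthonormal (M * E.proj t)

end Scalar

/-! ### Functions supported in `Ω` and orthonormal test systems -/

section Space

variable {X : Type*} [MeasurableSpace X] {μ : Measure X}
  {V : Type*} [NormedAddCommGroup V] [InnerProductSpace ℂ V] [CompleteSpace V]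

theorem isStarProjection_mulIndicator {Ω : Set X} (hΩ : MeasurableSet Ω) :
    IsStarProjection (mulIndicator μ V hΩ) := by
  refine ⟨?_, ?_⟩
  · refine ContinuousLinearMap.ext fun f => Lp.ext ?_
    show mulIndicator μ V hΩ (mulIndicator μ V hΩ f) =ᵐ[μ] _
    filter_upwards [mulIndicator_ae μ V hΩ f, mulIndicator_ae μ V hΩ (mulIndicator μ V hΩ f)]
      with x h1 h2
    rw [h2]
    by_cases hx : x ∈ Ω
    · rw [Set.indicator_of_mem hx]
    · rw [Set.indicator_of_notMem hx, h1, Set.indicator_of_notMem hx]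
  · rw [ContinuousLinearMap.isSelfAdjoint_iff_isSymmetric]
    intro f g
    show ⟪mulIndicator μ V hΩ f, g⟫_ℂ = ⟪f, mulIndicator μ V hΩ g⟫_ℂ
    rw [L2.inner_def, L2.inner_def]
    refine integral_congr_ae ?_
    filter_upwards [mulIndicator_ae μ V hΩ f, mulIndicator_ae μ V hΩ g] with x h1 h2
    rw [h1, h2]
    by_cases hx : x ∈ Ω
    · simp [Set.indicator_of_mem hx]
    · simp [Set.indicator_of_notMem hx]

omit [CompleteSpace V] in
theorem mulIndicator_eq_self {Ω : Set X} (hΩ : MeasurableSet Ω) {f : Lp V 2 μ}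
    (hf : ∀ᵐ x ∂μ, x ∉ Ω → (f : X → V) x = 0) : mulIndicator μ V hΩ f = f := by
  refine Lp.ext ?_
  filter_upwards [mulIndicator_ae μ V hΩ f, hf] with x h1 h2
  rw [h1]
  by_cases hx : x ∈ Ω
  · rw [Set.indicator_of_mem hx]
  · rw [Set.indicator_of_notMem hx, h2 hx]

theorem exists_orthonormal_of_le_dirichletCount (A : Lp V 2 μ →ₗ.[ℂ] Lp V 2 μ) {Ω : Set X}
    {lam : ℝ} {n : ℕ} (hn : (n : ℕ∞) ≤ dirichletCount A Ω lam) :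
    ∃ e : Fin n → Lp V 2 μ, Orthonormal ℂ e ∧
      (∀ k, ∀ᵐ x ∂μ, x ∉ Ω → (e k : X → V) x = 0) ∧
      ∀ k, energyPos A (e k) < ⊤ ∧ energy A (e k) ≤ (lam : EReal) := by
  rcases n with _ | m
  · exact ⟨Fin.elim0, ⟨fun i => i.elim0, fun i => i.elim0⟩, fun i => i.elim0, fun i => i.elim0⟩
  -- The supremum need not be attained, but the strict inequality with `m = n - 1` yields one space
  -- `L` of rank at least `n`; it may be infinite-dimensional, hence the finite span `S` below.
  have hm : (m : ℕ∞) < dirichletCount A Ω lam :=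
    lt_of_lt_of_le (by exact_mod_cast Nat.lt_succ_self m) hn
  rw [dirichletCount] at hm
  simp only [lt_iSup_iff] at hm
  obtain ⟨L, ⟨hL1, hL2⟩, hL⟩ := hm
  have hr : ((m + 1 : ℕ) : Cardinal) ≤ Module.rank ℂ L := by
    have h1 : ((m + 1 : ℕ) : ℕ∞) ≤ Cardinal.toENat (Module.rank ℂ L) := by
      have := Order.add_one_le_of_lt hL
      exact_mod_cast this
    exact (Cardinal.natCast_le_toENat).1 h1
  obtain ⟨s, hs1, hs2⟩ := le_rank_iff_exists_linearIndependent_finset.1 hr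
  let S : Submodule ℂ L := Submodule.span ℂ (s : Set L)
  have hfin : FiniteDimensional ℂ S := FiniteDimensional.span_finset ℂ s
  have hd : Module.finrank ℂ S = m + 1 := by
    rw [finrank_span_finset_eq_card hs2, hs1]
  let b := (stdOrthonormalBasis ℂ S).reindex (finCongr hd)
  have hb : Orthonormal ℂ fun k => ((b k : L) : Lp V 2 μ) := by
    have h1 := b.orthonormal.comp_linearIsometry S.subtypeₗᵢ
    exact h1.comp_linearIsometry L.subtypeₗᵢ
  refine ⟨_, hb, fun k => hL1 _ (b k : L).2, fun k => ?_⟩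
  have h := hL2 _ (b k : L).2
  rw [hb.1 k] at h
  simpa using h

end Space

/-! ### Rearrangement -/

section Rearrangement

theorem volume_pos_lt (a : ℝ≥0∞) : volume {x : ℝ | 0 < x ∧ ENNReal.ofReal x < a} = a := by
  rcases eq_or_ne a ⊤ with rfl | ha
  · have : {x : ℝ | 0 < x ∧ ENNReal.ofReal x < ⊤} = Set.Ioi 0 := by ext; simp
    rw [this, Real.volume_Ioi]
  · have : {x : ℝ | 0 < x ∧ ENNReal.ofReal x < a} = Set.Ioo 0 a.toReal := by
      ext x
      simp only [Set.mem_ofPred_eq, Set.mem_Ioo]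
      refine and_congr_right fun hx => ?_
      rw [ENNReal.ofReal_lt_iff_lt_toReal hx.le ha]
    rw [this, Real.volume_Ioo, sub_zero, ENNReal.ofReal_toReal ha]

theorem volume_pos_le (a : ℝ≥0∞) : volume {x : ℝ | 0 < x ∧ ENNReal.ofReal x ≤ a} = a := by
  rcases eq_or_ne a ⊤ with rfl | ha
  · have : {x : ℝ | 0 < x ∧ ENNReal.ofReal x ≤ ⊤} = Set.Ioi 0 := by ext; simp
    rw [this, Real.volume_Ioi]
  · have : {x : ℝ | 0 < x ∧ ENNReal.ofReal x ≤ a} = Set.Ioc 0 a.toReal := by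
      ext x
      simp only [Set.mem_ofPred_eq, Set.mem_Ioc]
      refine and_congr_right fun hx => ?_
      rw [ENNReal.ofReal_le_iff_le_toReal ha]
    rw [this, Real.volume_Ioc, sub_zero, ENNReal.ofReal_toReal ha]

variable {α : Type*} [MeasurableSpace α] {ν : Measure α} {g : α → ℝ≥0∞}

/-- Tonelli on the region under the graph. The strict and the weak version are both needed: they
make the level sets on the two sides of each later comparison match exactly, without discarding a
null set of levels. -/
theorem lintegral_eq_lintegral_meas_ofReal_lt [SFinite ν] (hg : Measurable g) :
    ∫⁻ u, g u ∂ν = ∫⁻ x in Set.Ioi (0 : ℝ), ν {u | ENNReal.ofReal x < g u} := by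
  have hm : MeasurableSet {p : α × ℝ | ENNReal.ofReal p.2 < g p.1} :=
    measurableSet_lt (ENNReal.measurable_ofReal.comp measurable_snd) (hg.comp measurable_fst)
  have h1 := Measure.prod_apply (μ := ν) (ν := volume.restrict (Set.Ioi (0 : ℝ))) hm
  have h2 := Measure.prod_apply_symm (μ := ν) (ν := volume.restrict (Set.Ioi (0 : ℝ))) hm
  rw [h1] at h2
  refine Eq.trans (lintegral_congr fun u => ?_) h2
  rw [Measure.restrict_apply (measurable_prodMk_left hm)]
  conv_lhs => rw [← volume_pos_lt (g u)]
  congr 1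
  ext x
  exact and_comm

theorem lintegral_eq_lintegral_meas_ofReal_le [SFinite ν] (hg : Measurable g) :
    ∫⁻ u, g u ∂ν = ∫⁻ x in Set.Ioi (0 : ℝ), ν {u | ENNReal.ofReal x ≤ g u} := by
  have hm : MeasurableSet {p : α × ℝ | ENNReal.ofReal p.2 ≤ g p.1} :=
    measurableSet_le (ENNReal.measurable_ofReal.comp measurable_snd) (hg.comp measurable_fst)
  have h1 := Measure.prod_apply (μ := ν) (ν := volume.restrict (Set.Ioi (0 : ℝ))) hm
  have h2 := Measure.prod_apply_symm (μ := ν) (ν := volume.restrict (Set.Ioi (0 : ℝ))) hm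
  rw [h1] at h2
  refine Eq.trans (lintegral_congr fun u => ?_) h2
  rw [Measure.restrict_apply (measurable_prodMk_left hm)]
  conv_lhs => rw [← volume_pos_le (g u)]
  congr 1
  ext x
  exact and_comm

theorem monotone_pseudoInv (F : ℝ → ℝ≥0∞) : Monotone (pseudoInv F) := by
  intro u v huv
  refine sSup_le_sSup (Set.image_mono fun x hx => ?_)
  exact le_trans hx (ENNReal.ofReal_le_ofReal huv)

theorem le_of_lt_pseudoInv {F : ℝ → ℝ≥0∞} (hF : Monotone F) {u x : ℝ}
    (h : (x : EReal) < pseudoInv F u) : F x ≤ ENNReal.ofReal u := by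
  obtain ⟨_, ⟨x', hx', rfl⟩, hlt⟩ := lt_sSup_iff.1 h
  exact (hF (EReal.coe_lt_coe_iff.1 hlt).le).trans hx'

theorem pseudoInv_le_of_lt {F : ℝ → ℝ≥0∞} (hF : Monotone F) {u x : ℝ}
    (h : ENNReal.ofReal u < F x) : pseudoInv F u ≤ x := by
  refine sSup_le ?_
  rintro _ ⟨y, hy, rfl⟩
  rw [EReal.coe_le_coe_iff]
  by_contra hxy
  exact absurd ((hF (not_le.1 hxy).le).trans hy) (not_le.2 h)

theorem measurable_posPart_pseudoInv (F : ℝ → ℝ≥0∞) :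
    Measurable fun u => (pseudoInv F u).toENNReal :=
  Monotone.measurable fun _ _ h => EReal.toENNReal_le_toENNReal (monotone_pseudoInv F h)

theorem measurable_negPart_pseudoInv (F : ℝ → ℝ≥0∞) :
    Measurable fun u => (-pseudoInv F u).toENNReal :=
  Antitone.measurable fun _ _ h =>
    EReal.toENNReal_le_toENNReal (EReal.neg_le_neg_iff.2 (monotone_pseudoInv F h))

variable {F : ℝ → ℝ≥0∞} {ν : Measure ℝ} [IsFiniteMeasure ν]

/-- If `F⁻¹(u) > x` then `ν(]-∞, x[) ≤ F(x) ≤ u`, so the level set of `F⁻¹` lies in an interval of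
length `ν([x, ∞[)`. -/
theorem phiPos_le_lintegral (hF : Monotone F) (h : ∀ t, ν (Set.Iio t) ≤ F t) :
    phiPos F (ν Set.univ) ≤ ∫⁻ t, ENNReal.ofReal t ∂ν := by
  rw [phiPos, lintegral_eq_lintegral_meas_ofReal_lt (measurable_posPart_pseudoInv F),
    lintegral_eq_lintegral_meas_ofReal_le ENNReal.measurable_ofReal]
  refine setLIntegral_mono' measurableSet_Ioi fun x hx => ?_
  have hx : 0 < x := hx
  have hset : {u : ℝ | ENNReal.ofReal x ≤ ENNReal.ofReal u} = Set.Ici x := by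
    ext u
    show ENNReal.ofReal x ≤ ENNReal.ofReal u ↔ x ≤ u
    refine ⟨fun hu => ?_, fun hu => ENNReal.ofReal_le_ofReal hu⟩
    by_contra hlt
    exact absurd hu (not_le.2 ((ENNReal.ofReal_lt_ofReal_iff hx).2 (not_le.1 hlt)))
  have hm : MeasurableSet {u : ℝ | ENNReal.ofReal x < (pseudoInv F u).toENNReal} :=
    measurableSet_lt measurable_const (measurable_posPart_pseudoInv F)
  rw [hset, Measure.restrict_apply hm]
  have hsub : {u : ℝ | ENNReal.ofReal x < (pseudoInv F u).toENNReal} ∩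
      {u : ℝ | 0 < u ∧ ENNReal.ofReal u < ν Set.univ} ⊆
      Set.Ico (ν (Set.Iio x)).toReal (ν Set.univ).toReal := by
    rintro u ⟨hu1, hu2, hu3⟩
    refine ⟨?_, (ENNReal.ofReal_lt_iff_lt_toReal hu2.le (measure_ne_top _ _)).1 hu3⟩
    have h1 : (x : EReal) < pseudoInv F u := by
      by_contra hle
      have := EReal.toENNReal_le_toENNReal (not_lt.1 hle)
      rw [EReal.real_coe_toENNReal] at this
      exact absurd hu1 (not_lt.2 this)
    exact ENNReal.toReal_le_of_le_ofReal hu2.le ((h x).trans (le_of_lt_pseudoInv hF h1))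
  refine (measure_mono hsub).trans ?_
  rw [Real.volume_Ico, ← Set.compl_Iio, measure_compl measurableSet_Iio (measure_ne_top _ _),
    ENNReal.ofReal_sub _ ENNReal.toReal_nonneg, ENNReal.ofReal_toReal (measure_ne_top _ _),
    ENNReal.ofReal_toReal (measure_ne_top _ _)]

/-- If `u < ν(]-∞, -x[) ≤ F(-x)` then `F⁻¹(u) ≤ -x`, so the level set of the negative part contains
an interval of length `ν(]-∞, -x[)`. -/
theorem lintegral_le_phiNeg (hF : Monotone F) (h : ∀ t, ν (Set.Iio t) ≤ F t) :
    ∫⁻ t, ENNReal.ofReal (-t) ∂ν ≤ phiNeg F (ν Set.univ) := by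
  rw [phiNeg, lintegral_eq_lintegral_meas_ofReal_le (measurable_negPart_pseudoInv F),
    lintegral_eq_lintegral_meas_ofReal_lt (g := fun t => ENNReal.ofReal (-t))
      (ENNReal.measurable_ofReal.comp measurable_neg)]
  refine setLIntegral_mono' measurableSet_Ioi fun x hx => ?_
  have hx : 0 < x := hx
  have hset : {u : ℝ | ENNReal.ofReal x < ENNReal.ofReal (-u)} = Set.Iio (-x) := by
    ext u
    show ENNReal.ofReal x < ENNReal.ofReal (-u) ↔ u < -x
    rw [ENNReal.ofReal_lt_ofReal_iff_of_nonneg hx.le, lt_neg]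
  have hm : MeasurableSet {u : ℝ | ENNReal.ofReal x ≤ (-pseudoInv F u).toENNReal} :=
    measurableSet_le measurable_const (measurable_negPart_pseudoInv F)
  rw [Measure.restrict_apply hm]
  refine le_trans (le_of_eq ?_) (measure_mono (s := {u : ℝ | 0 < u ∧
    ENNReal.ofReal u < ν (Set.Iio (-x))}) ?_)
  · rw [volume_pos_lt]
    exact congrArg ν hset
  · rintro u ⟨hu1, hu2⟩
    refine ⟨?_, hu1, hu2.trans_le (measure_mono (Set.subset_univ _))⟩
    have h1 := pseudoInv_le_of_lt hF (hu2.trans_le (h (-x)))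
    have h2 : (x : EReal) ≤ -pseudoInv F u := by
      rw [EReal.le_neg]
      simpa using h1
    simpa using EReal.toENNReal_le_toENNReal h2

theorem phiPos_mono (F : ℝ → ℝ≥0∞) : Monotone (phiPos F) := fun _ _ h =>
  lintegral_mono_set fun _ hu => ⟨hu.1, hu.2.trans_le h⟩

theorem phiNeg_mono (F : ℝ → ℝ≥0∞) : Monotone (phiNeg F) := fun _ _ h =>
  lintegral_mono_set fun _ hu => ⟨hu.1, hu.2.trans_le h⟩

theorem phiPos_top_le {F : ℝ → ℝ≥0∞} {c : ℝ≥0∞} (h : ∀ n : ℕ, phiPos F n ≤ c) :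
    phiPos F ⊤ ≤ c := by
  have hU : {u : ℝ | 0 < u ∧ ENNReal.ofReal u < ⊤} =
      ⋃ n : ℕ, {u : ℝ | 0 < u ∧ ENNReal.ofReal u < n} := by
    ext u
    simp only [Set.mem_ofPred_eq, Set.mem_iUnion, ENNReal.ofReal_lt_top, and_true, exists_and_left]
    exact (and_iff_left (ENNReal.exists_nat_gt ENNReal.ofReal_ne_top)).symm
  rw [phiPos, hU, setLIntegral_iUnion_of_directed]
  · exact iSup_le h
  · refine Monotone.directed_le fun m n hmn u hu => ⟨hu.1, hu.2.trans_le ?_⟩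
    exact_mod_cast hmn

/-- Removes subtraction, so that energy inequalities can be summed in `[0, ∞]`. For `b = ⊤` both
sides hold, thanks to `⊤ - ⊤ = ⊥` in `EReal`. -/
theorem coe_sub_coe_le_coe_iff {a b : ℝ≥0∞} {l : ℝ} :
    (a : EReal) - (b : EReal) ≤ (l : EReal) ↔
      a + ENNReal.ofReal (-l) ≤ b + ENNReal.ofReal l := by
  rcases eq_or_ne b ⊤ with rfl | hb
  · simp
  rcases eq_or_ne a ⊤ with rfl | ha
  · lift b to NNReal using hb
    have h1 : (⊤ : EReal) - ((b : ℝ≥0∞) : EReal) = ⊤ := EReal.top_sub_coe _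
    simp [h1]
  lift b to NNReal using hb
  lift a to NNReal using ha
  have h1 : ((a : ℝ≥0∞) : EReal) - ((b : ℝ≥0∞) : EReal) = ((a - b : ℝ) : EReal) := rfl
  rw [h1, EReal.coe_le_coe_iff, ← ENNReal.ofReal_coe_nnreal, ← ENNReal.ofReal_coe_nnreal]
  rcases le_total 0 l with hl | hl
  · rw [ENNReal.ofReal_of_nonpos (by linarith : -l ≤ 0), add_zero,
      ← ENNReal.ofReal_add b.coe_nonneg hl,
      ENNReal.ofReal_le_ofReal_iff (add_nonneg b.coe_nonneg hl)]
    constructor <;> intro h <;> linarith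
  · rw [ENNReal.ofReal_of_nonpos hl, add_zero, 
      ← ENNReal.ofReal_add a.coe_nonneg (neg_nonneg.2 hl), ENNReal.ofReal_le_ofReal_iff b.coe_nonneg]
    constructor <;> intro h <;> linarith

end Rearrangement

/-! ### The inequality for `φ_Ω` -/

section Main

variable {X : Type*} [MeasurableSpace X] {μ : Measure X}
  {V : Type*} [NormedAddCommGroup V] [InnerProductSpace ℂ V] [CompleteSpace V]
  {A : Lp V 2 μ →ₗ.[ℂ] Lp V 2 μ} {Ω : Set X} {lam : ℝ} {n : ℕ}

theorem monotone_specMeasure (A : Lp V 2 μ →ₗ.[ℂ] Lp V 2 μ) (hΩ : MeasurableSet Ω) :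
    Monotone (specMeasure A hΩ) :=
  posTrace_conj_mono _ (isStarProjection_mulIndicator hΩ)

theorem sum_scalarMeasure_Iio_le (hΩ : MeasurableSet Ω) {e : Fin n → Lp V 2 μ}
    (he : Orthonormal ℂ e) (hs : ∀ k, ∀ᵐ x ∂μ, x ∉ Ω → (e k : X → V) x = 0) (t : ℝ) :
    ∑ k, (spectralFamily A).scalarMeasure (e k) (Set.Iio t) ≤ specMeasure A hΩ t := by
  have h := sum_enorm_sq_le_posTrace ((spectralFamily A).isProj t)
    (isStarProjection_mulIndicator hΩ) he fun k => mulIndicator_eq_self hΩ (hs k)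
  rw [tsum_fintype] at h
  refine le_trans (le_of_eq (Finset.sum_congr rfl fun k _ => ?_)) h
  rw [SpectralFamily.scalarMeasure_Iio, ENNReal.ofReal_pow (norm_nonneg _), ofReal_norm]

/-- The inequality `φ(n) ≤ lam n` for `n` at most the Dirichlet counting function, in `[0, ∞]`. -/
theorem phi_natCast_le (hΩ : MeasurableSet Ω) (hn : (n : ℕ∞) ≤ dirichletCount A Ω lam) :
    phiPos (specMeasure A hΩ) n < ⊤ ∧
      phiPos (specMeasure A hΩ) n + n * ENNReal.ofReal (-lam) ≤
        phiNeg (specMeasure A hΩ) n + n * ENNReal.ofReal lam := by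
  obtain ⟨e, he, hs, hE⟩ := exists_orthonormal_of_le_dirichletCount A hn
  let ν : Measure ℝ := ∑ k, (spectralFamily A).scalarMeasure (e k)
  have hν : ν Set.univ = n := by
    simp [ν, Measure.finsetSum_apply, SpectralFamily.scalarMeasure_univ, he.1]
  have hle : ∀ t, ν (Set.Iio t) ≤ specMeasure A hΩ t := fun t => by
    simp only [ν, Measure.finsetSum_apply]
    exact sum_scalarMeasure_Iio_le hΩ he hs t
  have hP := phiPos_le_lintegral (monotone_specMeasure A hΩ) hle
  have hN := lintegral_le_phiNeg (monotone_specMeasure A hΩ) hle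
  rw [hν, lintegral_finsetSum_measure] at hP hN
  have hP' : phiPos (specMeasure A hΩ) n ≤ ∑ k, energyPos A (e k) := hP
  have hN' : ∑ k, energyNeg A (e k) ≤ phiNeg (specMeasure A hΩ) n := hN
  refine ⟨hP'.trans_lt (ENNReal.sum_lt_top.2 fun k _ => (hE k).1), ?_⟩
  have hsum : ∑ k, (energyPos A (e k) + ENNReal.ofReal (-lam)) ≤
      ∑ k, (energyNeg A (e k) + ENNReal.ofReal lam) :=
    Finset.sum_le_sum fun k _ => coe_sub_coe_le_coe_iff.1 (hE k).2
  simp only [Finset.sum_add_distrib, Finset.sum_const, Finset.card_univ, Fintype.card_fin,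
    nsmul_eq_mul] at hsum
  calc _ ≤ ∑ k, energyPos A (e k) + n * ENNReal.ofReal (-lam) := by gcongr
    _ ≤ _ := hsum
    _ ≤ _ := by gcongr

theorem phiPos_lt_top (hΩ : MeasurableSet Ω) {y : ℝ≥0∞} (hy : y ≠ ⊤)
    (hyN : y ≤ (dirichletCount A Ω lam : ℝ≥0∞)) : phiPos (specMeasure A hΩ) y < ⊤ := by
  obtain ⟨n, hn, hyn⟩ : ∃ n : ℕ, (n : ℕ∞) ≤ dirichletCount A Ω lam ∧ y ≤ n := by
    rcases eq_or_ne (dirichletCount A Ω lam) ⊤ with h | h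
    · obtain ⟨n, hn⟩ := ENNReal.exists_nat_gt hy
      exact ⟨n, by rw [h]; exact le_top, hn.le⟩
    · obtain ⟨n, hn⟩ := ENat.ne_top_iff_exists.1 h
      refine ⟨n, hn.le, ?_⟩
      rw [← hn] at hyN
      simpa using hyN
  exact (phiPos_mono _ hyn).trans_lt (phi_natCast_le hΩ hn).1

theorem phi_dirichletCount_le (A : Lp V 2 μ →ₗ.[ℂ] Lp V 2 μ) (hΩ : MeasurableSet Ω) (lam : ℝ) :
    phi (specMeasure A hΩ) (dirichletCount A Ω lam : ℝ≥0∞) ≤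
      (lam : EReal) * ((dirichletCount A Ω lam : ℝ≥0∞) : EReal) := by
  rcases eq_or_ne (dirichletCount A Ω lam) ⊤ with h | h
  · rw [h, ENat.toENNReal_top, phi]
    have hn : ∀ n : ℕ, (n : ℕ∞) ≤ dirichletCount A Ω lam := fun n => by rw [h]; exact le_top
    rcases lt_trichotomy lam 0 with hl | rfl | hl
    -- The negative part exceeds `n |lam|` for every `n`; the left side is then `⊥` whatever the
    -- positive part is.
    · have htop : phiNeg (specMeasure A hΩ) ⊤ = ⊤ := by
        refine ENNReal.eq_top_of_forall_nnreal_le fun r => ?_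
        obtain ⟨n, hrn⟩ := ENNReal.exists_nat_mul_gt (a := ENNReal.ofReal (-lam)) (b := r)
          (by simpa using hl) ENNReal.coe_ne_top
        have h1 := (phi_natCast_le hΩ (hn n)).2
        rw [ENNReal.ofReal_of_nonpos hl.le, mul_zero, add_zero] at h1
        calc (r : ℝ≥0∞) ≤ n * ENNReal.ofReal (-lam) := hrn.le
          _ ≤ _ := le_add_self
          _ ≤ _ := h1
          _ ≤ _ := phiNeg_mono _ le_top
      rw [htop]
      simp
    · have h1 : phiPos (specMeasure A hΩ) ⊤ ≤ phiNeg (specMeasure A hΩ) ⊤ := by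
        refine phiPos_top_le fun n => ?_
        have h1 := (phi_natCast_le hΩ (hn n)).2
        simp only [neg_zero, ENNReal.ofReal_zero, mul_zero, add_zero] at h1
        exact h1.trans (phiNeg_mono _ le_top)
      rw [EReal.coe_zero, zero_mul]
      have := (coe_sub_coe_le_coe_iff (l := 0)).2 (by simpa using h1)
      simpa using this
    · rw [EReal.coe_ennreal_top, EReal.coe_mul_top_of_pos hl]
      exact le_top
  · obtain ⟨n, hn⟩ := ENat.ne_top_iff_exists.1 h
    have h1 := (phi_natCast_le hΩ hn.le).2
    rw [← hn, ENat.toENNReal_coe, phi]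
    have h2 : (lam : EReal) * (((n : ℕ) : ℝ≥0∞) : EReal) = ((n * lam : ℝ) : EReal) := by
      rw [mul_comm]
      norm_cast
    rw [h2, coe_sub_coe_le_coe_iff, ← mul_neg, ENNReal.ofReal_mul (Nat.cast_nonneg n),
      ENNReal.ofReal_mul (Nat.cast_nonneg n), ENNReal.ofReal_natCast]
    exact h1

end Main

/-! ### The spectral theorem for positive self-adjoint operators -/

section Construction

variable {H : Type*} [NormedAddCommGroup H] [InnerProductSpace ℂ H] [CompleteSpace H]

theorem inner_apply_self_of_isStarProjection {P : H →L[ℂ] H} (hP : IsStarProjection P) (f : H) :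
    ⟪f, P f⟫_ℂ = ((‖P f‖ ^ 2 : ℝ) : ℂ) := by
  have hP' : ContinuousLinearMap.adjoint P = P := hP.isSelfAdjoint
  have hP2 : P (P f) = P f := by
    conv_rhs => rw [← hP.isIdempotentElem.eq]
    rfl
  have h : ⟪f, P f⟫_ℂ = ⟪P f, P f⟫_ℂ := by
    conv_rhs => rw [← ContinuousLinearMap.adjoint_inner_right, hP', hP2]
  rw [h, inner_self_eq_norm_sq_to_K]
  norm_cast

theorem norm_sub_sq_of_proj_le {P Q : H →L[ℂ] H} (hP : IsStarProjection P)
    (hQ : IsStarProjection Q) (hPQ : P * Q = P) (f : H) :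
    ‖Q f - P f‖ ^ 2 = ‖Q f‖ ^ 2 - ‖P f‖ ^ 2 := by
  have hR := hP.sub_of_mul_eq_left hQ hPQ
  have h := inner_apply_self_of_isStarProjection hR f
  rw [sub_apply, inner_sub_right, inner_apply_self_of_isStarProjection hP,
    inner_apply_self_of_isStarProjection hQ] at h
  exact_mod_cast h.symm

/-- For a projection `P i` below `Q`, Pythagoras gives `‖Q f - P i f‖² = ‖Q f‖² - ‖P i f‖²`. -/
theorem tendsto_of_normSq_tendsto {ι : Type*} {l : Filter ι} {P : ι → H →L[ℂ] H} {Q : H →L[ℂ] H}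
    (hP : ∀ i, IsStarProjection (P i)) (hQ : IsStarProjection Q)
    (hPQ : ∀ᶠ i in l, P i * Q = P i) {f : H}
    (h : Tendsto (fun i => ‖P i f‖ ^ 2) l (𝓝 (‖Q f‖ ^ 2))) :
    Tendsto (fun i => P i f) l (𝓝 (Q f)) := by
  rw [tendsto_iff_norm_sub_tendsto_zero]
  have h1 : Tendsto (fun i => ‖Q f‖ ^ 2 - ‖P i f‖ ^ 2) l (𝓝 0) := by
    rw [← sub_self (‖Q f‖ ^ 2)]
    exact tendsto_const_nhds.sub h
  have h2 : Tendsto (fun i => √(‖Q f‖ ^ 2 - ‖P i f‖ ^ 2)) l (𝓝 0) := by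
    simpa using h1.sqrt
  refine h2.congr' ?_
  filter_upwards [hPQ] with i hi
  rw [← norm_sub_sq_of_proj_le (hP i) hQ hi, Real.sqrt_sq (norm_nonneg _), norm_sub_rev]

/-- The limit axioms come from continuity of the finite measures `m f` along half-lines, which
yields convergence of norms and hence strong convergence. -/
theorem exists_spectralFamily_of_measure {P : ℝ → H →L[ℂ] H} (hP : ∀ t, IsStarProjection (P t))
    (hmul : ∀ s t, s ≤ t → P s * P t = P s) {m : H → Measure ℝ}
    (hm : ∀ f t, m f (Set.Iio t) = ENNReal.ofReal (‖P t f‖ ^ 2))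
    (hu : ∀ f, m f Set.univ = ENNReal.ofReal (‖f‖ ^ 2)) :
    ∃ E : SpectralFamily H, ∀ f, E.scalarMeasure f = m f := by
  have hfin : ∀ f, IsFiniteMeasure (m f) := fun f => ⟨by rw [hu]; exact ENNReal.ofReal_lt_top⟩
  have hnorm : ∀ f t, ‖P t f‖ ^ 2 = (m f).real (Set.Iio t) := fun f t => by
    rw [measureReal_def, hm, ENNReal.toReal_ofReal (by positivity)]
  have key : ∀ (f : H) (l : Filter ℝ) [l.IsCountablyGenerated] (S : Set ℝ), MeasurableSet S →
      (∀ x : ℝ, ∀ᶠ t in l, x ∈ Set.Iio t ↔ x ∈ S) →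
      Tendsto (fun t => ‖P t f‖ ^ 2) l (𝓝 ((m f).real S)) := by
    intro f l _ S hS h
    simp only [hnorm]
    exact (ENNReal.tendsto_toReal (measure_ne_top _ _)).comp
      (tendsto_measure_of_tendsto_indicator_of_isFiniteMeasure l (m f)
        (fun _ => measurableSet_Iio) h)
  let E : SpectralFamily H :=
    { proj := P
      isProj := hP
      proj_mul := hmul
      left_cont := by
        intro f t
        refine tendsto_of_normSq_tendsto hP (hP t) ?_ ?_
        · filter_upwards [self_mem_nhdsWithin] with s hs using hmul s t (le_of_lt hs)
        · rw [hnorm f t]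
          refine key f _ _ measurableSet_Iio fun x => ?_
          by_cases hx : x < t
          · filter_upwards [nhdsWithin_le_nhds (Ioi_mem_nhds hx)] with s hs
            exact iff_of_true hs hx
          · filter_upwards [self_mem_nhdsWithin] with s hs
            exact iff_of_false (fun h => hx (lt_trans h hs)) hx
      tendsto_bot := by
        intro f
        rw [tendsto_zero_iff_norm_tendsto_zero]
        have h := (key f atBot ∅ MeasurableSet.empty fun x => by
          filter_upwards [eventually_lt_atBot x] with t ht
          exact iff_of_false (not_lt.2 ht.le) (Set.notMem_empty x)).sqrt
        simpa [Real.sqrt_sq] using h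
      tendsto_top := by
        intro f
        refine tendsto_of_normSq_tendsto (Q := 1) hP (IsStarProjection.one _)
          (Eventually.of_forall fun s => mul_one _) ?_
        have : ‖(1 : H →L[ℂ] H) f‖ ^ 2 = (m f).real Set.univ := by
          rw [measureReal_def, hu, ENNReal.toReal_ofReal (by positivity)]
          rfl
        rw [this]
        refine key f _ _ MeasurableSet.univ fun x => ?_
        filter_upwards [eventually_gt_atTop x] with t ht
        exact iff_of_true ht trivial }
  refine ⟨E, fun f => ext_of_generate_finite _
    (BorelSpace.measurable_eq.trans (borel_eq_generateFrom_Iio ℝ)) isPiSystem_Iio ?_ ?_⟩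
  · rintro _ ⟨t, rfl⟩
    rw [SpectralFamily.scalarMeasure_Iio, hm]
  · rw [SpectralFamily.scalarMeasure_univ, hu]

end Construction

/-! ### Scalar spectral measures of bounded self-adjoint operators -/

section Bounded

variable {H : Type*} [NormedAddCommGroup H] [InnerProductSpace ℂ H] [CompleteSpace H]
  {T : H →L[ℂ] H}

/-- The scalar spectral measure of a bounded self-adjoint operator. -/
theorem exists_measure_integral_eq_cfc (hT : IsSelfAdjoint T) (f : H) :
    ∃ ν : Measure ℝ, IsFiniteMeasure ν ∧ ν (spectrum ℝ T)ᶜ = 0 ∧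
      ∀ g : ℝ → ℝ, Continuous g → ∫ x, g x ∂ν = (⟪f, cfc g T f⟫_ℂ).re := by
  -- Riesz–Markov for the positive functional `φ ↦ ⟨f, φ(T) f⟩` on the compact spectrum; the measure
  -- is then pushed forward to `ℝ`.
  let Λ : C_c(spectrum ℝ T, ℝ) →ₚ[ℝ] ℝ := PositiveLinearMap.mk₀
    { toFun := fun φ => (⟪f, cfcHom hT (φ : C(spectrum ℝ T, ℝ)) f⟫_ℂ).re
      map_add' := fun φ ψ => by
        have : ((φ + ψ : C_c(spectrum ℝ T, ℝ)) : C(spectrum ℝ T, ℝ)) = φ + ψ := rfl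
        rw [this, map_add, add_apply, inner_add_right, Complex.add_re]
      map_smul' := fun c φ => by
        have : ((c • φ : C_c(spectrum ℝ T, ℝ)) : C(spectrum ℝ T, ℝ)) =
          c • (φ : C(spectrum ℝ T, ℝ)) := rfl
        rw [this, map_smul, smul_apply, inner_smul_right_eq_smul]
        simp }
    (by
      intro φ hφ
      have h1 : 0 ≤ cfcHom hT (φ : C(spectrum ℝ T, ℝ)) := (cfcHom_nonneg_iff hT).2 hφ
      exact ((ContinuousLinearMap.nonneg_iff_isPositive _).1 h1).re_inner_nonneg_right f)
  refine ⟨(RealRMK.rieszMeasure Λ).map Subtype.val, inferInstance, ?_, fun g hg => ?_⟩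
  · rw [Measure.map_apply measurable_subtype_coe
      (spectrum.isClosed (𝕜 := ℝ) T).measurableSet.compl]
    have : ((↑) : spectrum ℝ T → ℝ) ⁻¹' (spectrum ℝ T)ᶜ = ∅ := by
      ext x
      simp
    rw [this, measure_empty]
  · rw [integral_map measurable_subtype_coe.aemeasurable hg.aestronglyMeasurable,
      cfc_apply g T hT hg.continuousOn]
    exact RealRMK.integral_rieszMeasure Λ (CompactlySupportedContinuousMap.continuousMapEquiv
      ⟨_, hg.continuousOn.domRestrict⟩)

end Bounded

section Bounded

variable {H : Type*} [NormedAddCommGroup H] [InnerProductSpace ℂ H] [CompleteSpace H]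
  {T : H →L[ℂ] H}

/-- The scalar spectral measure of a bounded self-adjoint operator at the vector `f`. -/
def boundedMeasure (hT : IsSelfAdjoint T) (f : H) : Measure ℝ :=
  (exists_measure_integral_eq_cfc hT f).choose

instance (hT : IsSelfAdjoint T) (f : H) : IsFiniteMeasure (boundedMeasure hT f) :=
  (exists_measure_integral_eq_cfc hT f).choose_spec.1

theorem ae_mem_spectrum (hT : IsSelfAdjoint T) (f : H) :
    ∀ᵐ x ∂boundedMeasure hT f, x ∈ spectrum ℝ T :=
  (exists_measure_integral_eq_cfc hT f).choose_spec.2.1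

theorem integral_boundedMeasure (hT : IsSelfAdjoint T) (f : H) {g : ℝ → ℝ} (hg : Continuous g) :
    ∫ x, g x ∂boundedMeasure hT f = (⟪f, cfc g T f⟫_ℂ).re :=
  (exists_measure_integral_eq_cfc hT f).choose_spec.2.2 g hg

theorem inner_cfc_left (g : ℝ → ℝ) (x y : H) : ⟪cfc g T x, y⟫_ℂ = ⟪x, cfc g T y⟫_ℂ := by
  have h : ContinuousLinearMap.adjoint (cfc g T) = cfc g T :=
    (cfc_predicate (p := IsSelfAdjoint) g T)
  conv_rhs => rw [← h]
  rw [ContinuousLinearMap.adjoint_inner_right]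

theorem cfc_mul_apply {g h : ℝ → ℝ} (hg : Continuous g) (hh : Continuous h) (f : H) :
    cfc (fun x => g x * h x) T f = cfc g T (cfc h T f) := by
  rw [cfc_mul g h T hg.continuousOn hh.continuousOn]
  rfl

theorem integral_sq_boundedMeasure (hT : IsSelfAdjoint T) (f : H) {g : ℝ → ℝ}
    (hg : Continuous g) : ∫ x, g x ^ 2 ∂boundedMeasure hT f = ‖cfc g T f‖ ^ 2 := by
  simp_rw [sq (g _)]
  rw [integral_boundedMeasure hT f (g := fun x => g x * g x) (hg.mul hg), cfc_mul_apply hg hg,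
    ← inner_cfc_left,
    inner_self_eq_norm_sq_to_K]
  norm_cast

theorem integrable_boundedMeasure (hT : IsSelfAdjoint T) (f : H) {g : ℝ → ℝ}
    (hg : Continuous g) : Integrable g (boundedMeasure hT f) := by
  obtain ⟨C, hC⟩ := (ContinuousFunctionalCalculus.isCompact_spectrum (R := ℝ)
    (p := IsSelfAdjoint) T).exists_bound_of_continuousOn hg.continuousOn
  refine Integrable.of_bound hg.aestronglyMeasurable C ?_
  filter_upwards [ae_mem_spectrum hT f] with x hx using hC x hx

theorem boundedMeasure_univ (hT : IsSelfAdjoint T) (f : H) :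
    boundedMeasure hT f Set.univ = ENNReal.ofReal (‖f‖ ^ 2) := by
  have h := integral_sq_boundedMeasure hT f (g := fun _ => 1) continuous_const
  rw [cfc_const_one ℝ T] at h
  simp only [one_pow, integral_const, smul_eq_mul, mul_one, one_apply_eq_self] at h
  rw [← h, ofReal_measureReal]

/-- For bounded continuous `φ`, `⟨g(T)f, φ(T)g(T)f⟩ = ⟨f, (gφg)(T)f⟩`, and such integrals determine
a finite measure. -/
theorem boundedMeasure_cfc (hT : IsSelfAdjoint T) (f : H) {g : ℝ → ℝ} (hg : Continuous g) :
    boundedMeasure hT (cfc g T f) =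
      (boundedMeasure hT f).withDensity fun x => ENNReal.ofReal (g x ^ 2) := by
  have hint := integrable_boundedMeasure hT f (hg.pow 2)
  have hfin : IsFiniteMeasure
      ((boundedMeasure hT f).withDensity fun x => ENNReal.ofReal (g x ^ 2)) :=
    isFiniteMeasure_withDensity_ofReal hint.2
  refine ext_of_forall_integral_eq_of_IsFiniteMeasure fun φ => ?_
  have hm : Measurable fun x => ENNReal.ofReal (g x ^ 2) :=
    ENNReal.measurable_ofReal.comp (hg.pow 2).measurable
  rw [integral_boundedMeasure hT _ φ.continuous, ← cfc_mul_apply φ.continuous hg, inner_cfc_left,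
    ← cfc_mul_apply hg (h := fun x => φ x * g x) (φ.continuous.mul hg),
    ← integral_boundedMeasure hT f (g := fun x => g x * (φ x * g x))
      (hg.mul (φ.continuous.mul hg)),
    integral_withDensity_eq_integral_toReal_smul hm (Eventually.of_forall fun _ =>
      ENNReal.ofReal_lt_top)]
  refine integral_congr_ae (Eventually.of_forall fun x => ?_)
  show g x * (φ x * g x) = (ENNReal.ofReal (g x ^ 2)).toReal * φ x
  rw [ENNReal.toReal_ofReal (sq_nonneg _)]
  ring

/-! #### Spectral projections -/

/-- The spectral projection `1_{]c,∞[}(T)`: the projection onto the closure of the range of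
`max (T - c) 0`. -/
def specProj (T : H →L[ℂ] H) (c : ℝ) : H →L[ℂ] H :=
  (LinearMap.range
    (cfc (fun x : ℝ => max (x - c) 0) T).toLinearMap).topologicalClosure.starProjection

theorem isStarProjection_specProj (T : H →L[ℂ] H) (c : ℝ) : IsStarProjection (specProj T c) :=
  isStarProjection_starProjection

theorem specProj_mul {c c' : ℝ} (h : c ≤ c') : specProj T c' * specProj T c = specProj T c' := by
  rcases h.eq_or_lt with rfl | h
  · exact (isStarProjection_specProj T c).isIdempotentElem
  refine Submodule.starProjection_comp_starProjection_of_le (Submodule.topologicalClosure_mono ?_)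
  rintro _ ⟨f, rfl⟩
  -- Factor `(x - c')₊ = (x - c)₊ k(x)`. Truncating the denominator of `k` at `c' - c` keeps it
  -- continuous and changes nothing where `x ≥ c'`.
  have hpos : ∀ x : ℝ, 0 < max (x - c) (c' - c) := fun x => lt_max_of_lt_right (sub_pos.2 h)
  have hk : Continuous fun x : ℝ => max (x - c') 0 / max (x - c) (c' - c) :=
    (by fun_prop : Continuous fun x : ℝ => max (x - c') 0).div (by fun_prop) fun x => (hpos x).ne'
  refine ⟨cfc (fun x : ℝ => max (x - c') 0 / max (x - c) (c' - c)) T f, ?_⟩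
  show cfc (fun x : ℝ => max (x - c) 0) T (cfc _ T f) = cfc _ T f
  rw [← cfc_mul_apply (by fun_prop) hk]
  congr 2
  funext x
  rcases le_total x c' with hx | hx
  · rw [max_eq_right (sub_nonpos.2 hx)]
    simp
  · have h1 : max (x - c) (c' - c) = x - c := max_eq_left (by linarith)
    have h2 : max (x - c) 0 = x - c := max_eq_left (by linarith)
    have h3 : x - c ≠ 0 := by linarith
    rw [h1, h2]
    field_simp

/-- With `s = (x - c)₊`, the functions `q n` are contractions of the form `k s`, so they kill the
complement of the range of `s(T)`; on that range `q n * s` is within `1/(n+1)` of `s`, and density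
finishes. -/
theorem tendsto_cfc_specProj (T : H →L[ℂ] H) (c : ℝ) (f : H) :
    Tendsto (fun n : ℕ => cfc (fun x : ℝ => (n + 1) * max (x - c) 0 / (1 + (n + 1) * max (x - c) 0))
      T f) atTop (𝓝 (specProj T c f)) := by
  set s : ℝ → ℝ := fun x => max (x - c) 0 with hs
  have hs0 : ∀ x, 0 ≤ s x := fun x => le_max_right _ _
  have hsc : Continuous s := by fun_prop
  have hden : ∀ (n : ℕ) (x : ℝ), 0 < 1 + (n + 1) * s x := fun n x => by
    have := hs0 x
    positivity
  set q : ℕ → ℝ → ℝ := fun n x => (n + 1) * s x / (1 + (n + 1) * s x) with hq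
  have hqc : ∀ n, Continuous (q n) := fun n =>
    (by fun_prop : Continuous fun x => (n + 1) * s x).div (by fun_prop) fun x => (hden n x).ne'
  have hkc : ∀ n : ℕ, Continuous fun x => ((n : ℝ) + 1) / (1 + (n + 1) * s x) := fun n =>
    continuous_const.div (by fun_prop) fun x => (hden n x).ne'
  have hqnorm : ∀ n, ‖cfc (q n) T‖ ≤ 1 := fun n => by
    refine norm_cfc_le zero_le_one fun x _ => ?_
    have h1 : 0 ≤ ((n : ℝ) + 1) * s x := mul_nonneg (by positivity) (hs0 x)
    rw [Real.norm_of_nonneg (div_nonneg h1 (hden n x).le), div_le_one (hden n x)]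
    linarith
  set K := (LinearMap.range (cfc s T).toLinearMap).topologicalClosure with hK
  have hker : cfc s T (f - specProj T c f) = 0 := by
    have h1 : f - K.starProjection f ∈ Kᗮ := Submodule.sub_starProjection_mem_orthogonal f
    refine ext_inner_left ℂ fun v => ?_
    rw [← inner_cfc_left, inner_zero_right]
    exact h1 _ (Submodule.le_topologicalClosure _ ⟨v, rfl⟩)
  have hq0 : ∀ n, cfc (q n) T f = cfc (q n) T (specProj T c f) := fun n => by
    have h1 : cfc (q n) T (f - specProj T c f) = 0 := by
      have h2 : q n = fun x => ((n : ℝ) + 1) / (1 + (n + 1) * s x) * s x := by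
        funext x
        simp only [hq]
        ring
      rw [h2, cfc_mul_apply (hkc n) hsc, hker, map_zero]
    rwa [map_sub, sub_eq_zero] at h1
  show Tendsto (fun n => cfc (q n) T f) atTop _
  simp_rw [hq0]
  have hmem : specProj T c f ∈ K := Submodule.starProjection_apply_mem _ _
  generalize specProj T c f = g at hmem
  rw [Metric.tendsto_atTop]
  intro ε hε
  obtain ⟨_, ⟨h, rfl⟩, hh⟩ := Metric.mem_closure_iff.1 hmem (ε / 4) (by positivity)
  obtain ⟨N, hN⟩ := exists_nat_gt (‖h‖ / (ε / 4))
  refine ⟨N, fun n hn => ?_⟩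
  have hh' : ‖g - cfc s T h‖ < ε / 4 := by rw [← dist_eq_norm]; exact hh
  have hd : ‖cfc (q n) T (cfc s T h) - cfc s T h‖ ≤ 1 / (n + 1) * ‖h‖ := by
    rw [← cfc_mul_apply (hqc n) hsc, ← sub_apply, ← cfc_sub (fun x => q n x * s x) s T
      ((hqc n).mul hsc).continuousOn hsc.continuousOn]
    refine (ContinuousLinearMap.le_opNorm _ _).trans ?_
    gcongr
    refine norm_cfc_le (by positivity) fun x _ => ?_
    have h1 : q n x * s x - s x = -(s x / (1 + (n + 1) * s x)) := by
      have := (hden n x).ne'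
      simp only [hq]
      field_simp
      ring
    rw [h1, norm_neg, Real.norm_of_nonneg (div_nonneg (hs0 x) (hden n x).le),
      div_le_div_iff₀ (hden n x) (by positivity)]
    linarith [hs0 x]
  have hn' : 1 / ((n : ℝ) + 1) * ‖h‖ < ε / 4 := by
    have h1 : ‖h‖ < N * (ε / 4) := (div_lt_iff₀ (by positivity)).1 hN
    have h2 : (N : ℝ) ≤ n := by exact_mod_cast hn
    rw [one_div, inv_mul_lt_iff₀ (by positivity)]
    nlinarith
  have h3 : ‖cfc (q n) T (g - cfc s T h)‖ ≤ ‖g - cfc s T h‖ := by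
    refine (ContinuousLinearMap.le_opNorm _ _).trans ?_
    exact mul_le_of_le_one_left (norm_nonneg _) (hqnorm n)
  rw [dist_eq_norm]
  calc ‖cfc (q n) T g - g‖ = ‖cfc (q n) T (g - cfc s T h)
        + (cfc (q n) T (cfc s T h) - cfc s T h) + -(g - cfc s T h)‖ := by
        rw [map_sub]
        congr 1
        abel
    _ ≤ ‖cfc (q n) T (g - cfc s T h)‖ + ‖cfc (q n) T (cfc s T h) - cfc s T h‖
        + ‖-(g - cfc s T h)‖ := norm_add₃_le
    _ < ε := by
        rw [norm_neg]
        linarith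

/-- The functions of `tendsto_cfc_specProj` also converge pointwise to the indicator of `]c, ∞[`;
dominated convergence identifies the two limits. -/
theorem boundedMeasure_Ioi (hT : IsSelfAdjoint T) (f : H) (c : ℝ) :
    boundedMeasure hT f (Set.Ioi c) = ENNReal.ofReal (‖specProj T c f‖ ^ 2) := by
  set q : ℕ → ℝ → ℝ := fun n x => (n + 1) * max (x - c) 0 / (1 + (n + 1) * max (x - c) 0) with hq
  have hden : ∀ (n : ℕ) (x : ℝ), 0 < 1 + ((n : ℝ) + 1) * max (x - c) 0 := fun n x => by
    have := le_max_right (x - c) 0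
    positivity
  have hqc : ∀ n, Continuous (q n) := fun n =>
    (by fun_prop : Continuous fun x => ((n : ℝ) + 1) * max (x - c) 0).div (by fun_prop)
      fun x => (hden n x).ne'
  have h1 : Tendsto (fun n => ∫ x, q n x ∂boundedMeasure hT f) atTop
      (𝓝 (‖specProj T c f‖ ^ 2)) := by
    have h2 := ((Complex.continuous_re.tendsto _).comp
      ((tendsto_const_nhds (x := f)).inner (tendsto_cfc_specProj T c f)))
    rw [inner_apply_self_of_isStarProjection (isStarProjection_specProj T c),
      Complex.ofReal_re] at h2
    refine h2.congr fun n => ?_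
    rw [integral_boundedMeasure hT f (hqc n)]
    rfl
  have h3 : Tendsto (fun n => ∫ x, q n x ∂boundedMeasure hT f) atTop
      (𝓝 (∫ x, (Set.Ioi c).indicator 1 x ∂boundedMeasure hT f)) := by
    refine tendsto_integral_of_dominated_convergence (fun _ => 1)
      (fun n => (hqc n).aestronglyMeasurable) (integrable_const _) (fun n => ?_) ?_
    · refine Eventually.of_forall fun x => ?_
      have h4 : 0 ≤ ((n : ℝ) + 1) * max (x - c) 0 :=
        mul_nonneg (by positivity) (le_max_right _ _)
      rw [Real.norm_of_nonneg (div_nonneg h4 (hden n x).le), div_le_one (hden n x)]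
      linarith
    · refine Eventually.of_forall fun x => ?_
      by_cases hx : c < x
      · rw [Set.indicator_of_mem (Set.mem_Ioi.2 hx), Pi.one_apply]
        have hy : 0 < max (x - c) 0 := lt_max_of_lt_left (sub_pos.2 hx)
        have h5 : Tendsto (fun n : ℕ => 1 - 1 / (((n : ℝ) + 1) * max (x - c) 0 + 1)) atTop
            (𝓝 (1 - 0)) := by
          refine tendsto_const_nhds.sub (tendsto_const_nhds.div_atTop ?_)
          refine tendsto_atTop_add_const_right _ _ (Tendsto.atTop_mul_const hy ?_)
          exact tendsto_atTop_add_const_right _ _ tendsto_natCast_atTop_atTop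
        rw [sub_zero] at h5
        refine h5.congr fun n => ?_
        have := (hden n x).ne'
        simp only [hq]
        rw [add_comm (((n : ℝ) + 1) * max (x - c) 0) 1]
        field_simp
        ring
      · rw [Set.indicator_of_notMem (by simpa using hx)]
        refine tendsto_const_nhds.congr fun n => ?_
        simp [hq, max_eq_right (sub_nonpos.2 (not_lt.1 hx))]
  have h4 := tendsto_nhds_unique h1 h3
  rw [integral_indicator_one measurableSet_Ioi] at h4
  rw [h4, ofReal_measureReal]

theorem specProj_zero (hT : T.IsPositive) (hd : DenseRange T) : specProj T 0 = 1 := by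
  have h1 : cfc (fun x : ℝ => max (x - 0) 0) T = T := by
    conv_rhs => rw [← cfc_id ℝ T hT.isSelfAdjoint]
    refine cfc_congr fun x hx => ?_
    have h0 : 0 ≤ x := spectrum_nonneg_of_nonneg
      ((ContinuousLinearMap.nonneg_iff_isPositive _).2 hT) hx
    simp [h0]
  have h2 : (LinearMap.range T.toLinearMap).topologicalClosure = ⊤ :=
    Submodule.dense_iff_topologicalClosure_eq_top.1 hd
  have h3 : (LinearMap.range (cfc (fun x : ℝ => max (x - 0) 0) T).toLinearMap).topologicalClosure
      = ⊤ := by rw [h1, h2]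
  refine ContinuousLinearMap.ext fun f => ?_
  exact Submodule.starProjection_eq_self_iff.2 (h3 ▸ Submodule.mem_top)

end Bounded

/-! ### From the resolvent to the unbounded operator -/

section Resolution

variable {H : Type*} [NormedAddCommGroup H] [InnerProductSpace ℂ H] [CompleteSpace H]
  {T : H →L[ℂ] H}

theorem ae_pos_boundedMeasure (hT : T.IsPositive) (hd : DenseRange T) (f : H) :
    ∀ᵐ x ∂boundedMeasure hT.isSelfAdjoint f, 0 < x := by
  rw [ae_iff_measure_eq measurableSet_Ioi.nullMeasurableSet, boundedMeasure_univ]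
  show boundedMeasure hT.isSelfAdjoint f (Set.Ioi 0) = _
  rw [boundedMeasure_Ioi, specProj_zero hT hd, one_apply_eq_self]

/-- The spectral family of `T⁻¹ - 1`, for a positive bounded `T` with dense range. -/
theorem exists_spectralFamily_inv_sub_one (hT : T.IsPositive) (hd : DenseRange T) :
    ∃ E : SpectralFamily H, ∀ f, E.scalarMeasure f =
      (boundedMeasure hT.isSelfAdjoint f).map fun x => x⁻¹ - 1 := by
  have hφ : Measurable fun x : ℝ => x⁻¹ - 1 := measurable_inv.sub_const 1
  refine exists_spectralFamily_of_measure
    -- For `x > 0`, `x⁻¹ - 1 < t` means `x > (1 + t)⁻¹` if `t > -1`, and never happens otherwise.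
    (P := fun t => if t ≤ -1 then 0 else specProj T (1 + t)⁻¹) (fun t => ?_) (fun s t hst => ?_)
    (fun f t => ?_) fun f => ?_
  · show IsStarProjection (if t ≤ -1 then (0 : H →L[ℂ] H) else specProj T (1 + t)⁻¹)
    split_ifs
    · exact IsStarProjection.zero _
    · exact isStarProjection_specProj T _
  · by_cases hs : s ≤ -1
    · simp [hs]
    · have ht : ¬ t ≤ -1 := fun h => hs (hst.trans h)
      simp only [hs, ht, if_false]
      refine specProj_mul ?_
      have : 0 < 1 + s := by linarith
      gcongr
  · rw [Measure.map_apply hφ measurableSet_Iio]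
    by_cases ht : t ≤ -1
    · simp only [ht, if_true, zero_apply, norm_zero]
      rw [zero_pow two_ne_zero, ENNReal.ofReal_zero, ← compl_mem_ae_iff]
      filter_upwards [ae_pos_boundedMeasure hT hd f] with x hx
      have : 0 < x⁻¹ := inv_pos.2 hx
      simp only [Set.mem_compl_iff, Set.mem_preimage, Set.mem_Iio]
      linarith
    · simp only [ht, if_false]
      rw [← boundedMeasure_Ioi hT.isSelfAdjoint]
      refine measure_congr ?_
      filter_upwards [ae_pos_boundedMeasure hT hd f] with x hx
      refine propext ?_
      show x⁻¹ - 1 < t ↔ (1 + t)⁻¹ < x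
      rw [inv_lt_comm₀ (by linarith) hx]
      constructor <;> intro h <;> linarith
  · rw [Measure.map_apply hφ MeasurableSet.univ, Set.preimage_univ, boundedMeasure_univ]

variable {A : H →ₗ.[ℂ] H}

theorem exists_mem_domain_of_inner (hA : IsSelfAdjoint A) {y w : H}
    (h : ∀ x : A.domain, ⟪w, (x : H)⟫_ℂ = ⟪y, A x⟫_ℂ) : ∃ hy : y ∈ A.domain, A ⟨y, hy⟩ = w := by
  have key : ∃ hy : y ∈ A.adjoint.domain, A.adjoint ⟨y, hy⟩ = w :=
    ⟨LinearPMap.mem_adjoint_domain_of_exists y ⟨w, h⟩,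
      LinearPMap.adjoint_apply_eq hA.dense_domain _ h⟩
  rwa [LinearPMap.isSelfAdjoint_def.1 hA] at key

theorem inner_symm_of_isSelfAdjoint (hA : IsSelfAdjoint A) (x y : A.domain) :
    ⟪A x, (y : H)⟫_ℂ = ⟪(x : H), A y⟫_ℂ := by
  have h := LinearPMap.adjoint_isFormalAdjoint hA.dense_domain
  rw [LinearPMap.isSelfAdjoint_def.1 hA] at h
  exact h x y

/-- The resolvent `(A + 1)⁻¹` of a positive self-adjoint operator. -/
theorem exists_resolvent (hA : IsSelfAdjoint A) (hpos : IsPositiveOp A) :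
    ∃ T : H →L[ℂ] H, (∀ f : A.domain, T (f + A f) = f) ∧
      ∀ h, ∃ hd : T h ∈ A.domain, A ⟨T h, hd⟩ = h - T h := by
  let B : A.domain →ₗ[ℂ] H := A.domain.subtype + A.toFun
  have hB : ∀ f : A.domain, B f = f + A f := fun f => rfl
  -- Positivity gives `‖f‖² ≤ ⟨f, (1 + A) f⟩`; this yields injectivity, closed range and the bound
  -- on the inverse.
  have hnorm : ∀ f : A.domain, ‖(f : H)‖ ≤ ‖B f‖ := fun f => by
    have h1 : ‖(f : H)‖ ^ 2 ≤ (⟪(f : H), B f⟫_ℂ).re := by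
      rw [hB, inner_add_right, Complex.add_re, inner_self_eq_norm_sq_to_K]
      have h2 := hpos f
      have h3 : (((‖(f : H)‖ : ℝ) : ℂ) ^ 2).re = ‖(f : H)‖ ^ 2 := by norm_cast
      have h4 : (((RCLike.ofReal ‖(f : H)‖ : ℂ)) ^ 2).re = ‖(f : H)‖ ^ 2 := h3
      rw [h4]
      linarith
    have h2 : (⟪(f : H), B f⟫_ℂ).re ≤ ‖(f : H)‖ * ‖B f‖ :=
      re_inner_le_norm (𝕜 := ℂ) _ _
    rcases (norm_nonneg (f : H)).eq_or_lt with h0 | h0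
    · rw [← h0]
      exact norm_nonneg _
    · refine le_of_mul_le_mul_left ?_ h0
      rw [← sq]
      exact h1.trans h2
  have hinj : Function.Injective B := by
    rw [injective_iff_map_eq_zero]
    intro f hf
    have := hnorm f
    rw [hf, norm_zero] at this
    exact Subtype.ext (norm_le_zero_iff.1 this)
  have hclosed : IsClosed ((LinearMap.range B : Submodule ℂ H) : Set H) := by
    refine isClosed_of_closure_subset fun h hh => ?_
    obtain ⟨u, hu, hlim⟩ := mem_closure_iff_seq_limit.1 hh
    choose f hf using hu
    have hc : CauchySeq fun n => (f n : H) := by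
      rw [Metric.cauchySeq_iff]
      intro ε hε
      obtain ⟨N, hN⟩ := Metric.cauchySeq_iff.1 hlim.cauchySeq ε hε
      refine ⟨N, fun m hm n hn => lt_of_le_of_lt ?_ (hN m hm n hn)⟩
      rw [dist_eq_norm, dist_eq_norm, ← hf, ← hf, ← map_sub]
      exact hnorm (f m - f n)
    obtain ⟨g, hg⟩ := cauchySeq_tendsto_of_complete hc
    have hA1 : Tendsto (fun n => A (f n)) atTop (𝓝 (h - g)) := by
      refine (hlim.sub hg).congr fun n => ?_
      rw [← hf, hB, add_sub_cancel_left]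
    have hcl : _root_.IsClosed (A.graph : Set (H × H)) := hA.isClosed
    have hmem : (g, h - g) ∈ A.graph :=
      hcl.mem_of_tendsto (hg.prodMk_nhds hA1) (Eventually.of_forall fun n => A.mem_graph (f n))
    obtain ⟨y, hy1, hy2⟩ := (LinearPMap.mem_graph_iff A).1 hmem
    refine ⟨y, ?_⟩
    rw [hB, hy1, hy2]
    simp
  have hsurj : Function.Surjective B := by
    have : CompleteSpace (LinearMap.range B) := hclosed.completeSpace_coe
    rw [← LinearMap.range_eq_top, ← Submodule.orthogonal_eq_bot_iff, Submodule.eq_bot_iff]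
    intro g hg
    -- A vector `g` orthogonal to the range satisfies `A* g = -g`, so `A g = -g` by
    -- self-adjointness, and positivity forces `g = 0`.
    have h1 : ∀ x : A.domain, ⟪-g, (x : H)⟫_ℂ = ⟪g, A x⟫_ℂ := fun x => by
      have h2 := (Submodule.mem_orthogonal' _ _).1 hg (B x) ⟨x, rfl⟩
      rw [hB, inner_add_right] at h2
      rw [inner_neg_left]
      linear_combination -h2
    obtain ⟨hy, hy2⟩ := exists_mem_domain_of_inner hA h1
    have h3 := hpos ⟨g, hy⟩
    rw [hy2, inner_neg_right, Complex.neg_re, inner_self_eq_norm_sq_to_K] at h3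
    have h4 : (((RCLike.ofReal ‖g‖ : ℂ)) ^ 2).re = ‖g‖ ^ 2 := by
      show (((‖g‖ : ℝ) : ℂ) ^ 2).re = ‖g‖ ^ 2
      norm_cast
    have h5 : ‖g‖ ^ 2 ≤ 0 := by
      have h6 : 0 ≤ -(((RCLike.ofReal ‖g‖ : ℂ)) ^ 2).re := h3
      linarith
    exact norm_eq_zero.1 (pow_eq_zero_iff two_ne_zero |>.1 (le_antisymm h5 (sq_nonneg _)))
  let e := LinearEquiv.ofBijective B ⟨hinj, hsurj⟩
  let T : H →L[ℂ] H := LinearMap.mkContinuous (A.domain.subtype ∘ₗ e.symm.toLinearMap) 1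
    (fun h => by
      rw [one_mul]
      refine (hnorm (e.symm h)).trans (le_of_eq ?_)
      exact congrArg norm (e.apply_symm_apply h))
  have hTe : ∀ h, T h = (e.symm h : H) := fun h => rfl
  refine ⟨T, fun f => ?_, fun h => ⟨(e.symm h).2, ?_⟩⟩
  · rw [← hB, hTe]
    exact congrArg Subtype.val (e.symm_apply_apply f)
  · have h1 : B (e.symm h) = h := e.apply_symm_apply h
    rw [hB] at h1
    exact eq_sub_of_add_eq' h1

/-- The continuous `g n` regularise `1/x` from below: the vectors `g n(T) f` have norm at most `√C`,
and their images under `T` tend to `f`. Hence `⟨f, (1 + A) y⟩ = lim ⟨g n(T) f, y⟩` is bounded by `√C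
‖y‖`, so `f` lies in the domain of `A* = A`. -/
theorem mem_domain_of_lintegral_lt_top (hA : IsSelfAdjoint A) (hT : T.IsPositive)
    (hd : DenseRange T) (hTA : ∀ f : A.domain, T (f + A f) = f) {f : H}
    (hf : ∫⁻ x, ENNReal.ofReal ((x⁻¹) ^ 2) ∂boundedMeasure hT.isSelfAdjoint f < ⊤) :
    f ∈ A.domain := by
  have hsa := hT.isSelfAdjoint
  set ν := boundedMeasure hsa f with hν
  set g : ℕ → ℝ → ℝ := fun n x => x / (x ^ 2 + 1 / (n + 1)) with hg
  have hden : ∀ (n : ℕ) (x : ℝ), 0 < x ^ 2 + 1 / ((n : ℝ) + 1) := fun n x => by positivity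
  have hgc : ∀ n, Continuous (g n) := fun n =>
    continuous_id.div (by fun_prop) fun x => (hden n x).ne'
  set C := (∫⁻ x, ENNReal.ofReal ((x⁻¹) ^ 2) ∂ν).toReal with hC
  have hbound : ∀ n, ‖cfc (g n) T f‖ ≤ √C := fun n => by
    refine Real.le_sqrt_of_sq_le ?_
    rw [← integral_sq_boundedMeasure hsa f (hgc n), integral_eq_lintegral_of_nonneg_ae
      (Eventually.of_forall fun x => sq_nonneg _) ((hgc n).pow 2).aestronglyMeasurable]
    refine ENNReal.toReal_mono hf.ne (lintegral_mono_ae ?_)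
    filter_upwards [ae_pos_boundedMeasure hT hd f] with x hx
    refine ENNReal.ofReal_le_ofReal (pow_le_pow_left₀ (div_nonneg hx.le (hden n x).le) ?_ 2)
    rw [div_le_iff₀ (hden n x)]
    have h1 : 0 ≤ 1 / ((n : ℝ) + 1) := by positivity
    calc x = x⁻¹ * x ^ 2 := by field_simp
      _ ≤ _ := by
        gcongr
        linarith
  have hid : cfc (fun x : ℝ => x) T = T := cfc_id' ℝ T hsa
  have hlim : Tendsto (fun n => T (cfc (g n) T f)) atTop (𝓝 f) := by
    rw [tendsto_iff_norm_sub_tendsto_zero]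
    have h1 : ∀ n, ‖T (cfc (g n) T f) - f‖ ^ 2 = ∫ x, (x * g n x - 1) ^ 2 ∂ν := fun n => by
      have hc : Continuous fun x => x * g n x := continuous_id.mul (hgc n)
      rw [integral_sq_boundedMeasure hsa f (g := fun x => x * g n x - 1) (hc.sub continuous_const),
        cfc_sub (fun x => x * g n x) (fun _ => 1) T hc.continuousOn continuousOn_const,
        cfc_const_one ℝ T, sub_apply, cfc_mul_apply continuous_id' (hgc n), hid,
        one_apply_eq_self]
    have hpt : ∀ (n : ℕ) (x : ℝ), x * g n x - 1 = -((1 / ((n : ℝ) + 1)) / (x ^ 2 + 1 / (n + 1))) :=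
      fun n x => by
        have := (hden n x).ne'
        simp only [hg]
        rw [eq_neg_iff_add_eq_zero, mul_div_assoc', div_sub_one this, ← add_div]
        rw [div_eq_zero_iff]
        left
        ring
    have h2 : Tendsto (fun n => ∫ x, (x * g n x - 1) ^ 2 ∂ν) atTop (𝓝 (∫ _, (0 : ℝ) ∂ν)) := by
      refine tendsto_integral_of_dominated_convergence (fun _ => 1)
        (fun n => (((continuous_id.mul (hgc n)).sub continuous_const).pow 2).aestronglyMeasurable)
        (integrable_const _) (fun n => Eventually.of_forall fun x => ?_) ?_
      · rw [hpt, neg_sq, Real.norm_of_nonneg (sq_nonneg _)]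
        refine pow_le_one₀ (by positivity) ?_
        rw [div_le_one (hden n x)]
        linarith [sq_nonneg x]
      · filter_upwards [ae_pos_boundedMeasure hT hd f] with x hx
        have h3 : Tendsto (fun n : ℕ => 1 / ((n : ℝ) + 1)) atTop (𝓝 0) :=
          tendsto_one_div_add_atTop_nhds_zero_nat
        have h4 : Tendsto (fun n : ℕ => ((1 / ((n : ℝ) + 1)) / (x ^ 2 + 1 / (n + 1))) ^ 2) atTop
            (𝓝 ((0 / (x ^ 2 + 0)) ^ 2)) :=
          ((h3.div (tendsto_const_nhds.add h3) (by positivity)).pow 2)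
        rw [zero_div, zero_pow two_ne_zero] at h4
        refine h4.congr fun n => ?_
        rw [hpt, neg_sq]
    rw [integral_zero] at h2
    have h3 := h2.sqrt
    rw [Real.sqrt_zero] at h3
    refine h3.congr fun n => ?_
    rw [← h1, Real.sqrt_sq (norm_nonneg _)]
  rw [← LinearPMap.isSelfAdjoint_def.1 hA, LinearPMap.mem_adjoint_domain_iff]
  refine AddMonoidHomClass.continuous_of_bound _ (√C + ‖f‖) fun y => ?_
  show ‖⟪f, A y⟫_ℂ‖ ≤ (√C + ‖f‖) * ‖(y : H)‖
  have h1 : ‖⟪f, (y : H) + A y⟫_ℂ‖ ≤ √C * ‖(y : H)‖ := by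
    refine le_of_tendsto ((hlim.inner (tendsto_const_nhds (x := (y : H) + A y))).norm)
      (Eventually.of_forall fun n => ?_)
    have h2 : ⟪T (cfc (g n) T f), (y : H) + A y⟫_ℂ = ⟪cfc (g n) T f, (y : H)⟫_ℂ := by
      conv_lhs => rw [← hid, inner_cfc_left, hid]
      rw [hTA]
    rw [h2]
    exact (norm_inner_le_norm _ _).trans (by gcongr; exact hbound n)
  have h2 : ⟪f, A y⟫_ℂ = ⟪f, (y : H) + A y⟫_ℂ - ⟪f, (y : H)⟫_ℂ := by
    rw [inner_add_right]
    ring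
  rw [h2, add_mul]
  exact (norm_sub_le _ _).trans (add_le_add h1 (norm_inner_le_norm _ _))

/-- The spectral theorem for positive self-adjoint operators. -/
theorem exists_isResolutionOf (hA : IsSelfAdjoint A) (hpos : IsPositiveOp A) :
    ∃ E : SpectralFamily H, E.IsResolutionOf A := by
  obtain ⟨T, hTA, hAT⟩ := exists_resolvent hA hpos
  have hsymm : ∀ x y, ⟪T x, y⟫_ℂ = ⟪x, T y⟫_ℂ := fun x y => by
    obtain ⟨hx, hx'⟩ := hAT x
    obtain ⟨hy, hy'⟩ := hAT y
    have h := inner_symm_of_isSelfAdjoint hA ⟨T x, hx⟩ ⟨T y, hy⟩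
    rw [hx', hy', inner_sub_left, inner_sub_right] at h
    linear_combination -h
  have hT : T.IsPositive := by
    refine ⟨hsymm, fun x => ?_⟩
    obtain ⟨hx, hx'⟩ := hAT x
    have h := hpos ⟨T x, hx⟩
    rw [hx'] at h
    have h1 : (⟪T x, x⟫_ℂ).re = (⟪T x, x - T x⟫_ℂ).re + (⟪T x, T x⟫_ℂ).re := by
      rw [← Complex.add_re, ← inner_add_right, sub_add_cancel]
    have h2 : 0 ≤ (⟪T x, T x⟫_ℂ).re := inner_self_nonneg (𝕜 := ℂ)
    show 0 ≤ (⟪T x, x⟫_ℂ).re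
    rw [h1]
    exact add_nonneg h h2
  have hd : DenseRange T := hA.dense_domain.mono fun f hf => ⟨_, hTA ⟨f, hf⟩⟩
  have hsa := hT.isSelfAdjoint
  have hid : cfc (fun x : ℝ => x) T = T := cfc_id' ℝ T hsa
  have hφ : Measurable fun x : ℝ => x⁻¹ - 1 := measurable_inv.sub_const 1
  have hν : ∀ h, boundedMeasure hsa (T h) =
      (boundedMeasure hsa h).withDensity fun x => ENNReal.ofReal (x ^ 2) := fun h => by
    have := boundedMeasure_cfc hsa h (g := fun x => x) continuous_id'
    rwa [hid] at this
  have hm2 : Measurable fun x : ℝ => ENNReal.ofReal (x ^ 2) := by fun_prop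
  obtain ⟨E, hE⟩ := exists_spectralFamily_inv_sub_one hT hd
  refine ⟨E, fun f => ?_, fun f => ?_⟩
  · have hmap : ∫⁻ t, ENNReal.ofReal (t ^ 2) ∂E.scalarMeasure f =
        ∫⁻ x, ENNReal.ofReal ((x⁻¹ - 1) ^ 2) ∂boundedMeasure hsa f := by
      rw [hE, lintegral_map hm2 hφ]
    rw [hmap]
    constructor
    · intro hf
      have hf' := hTA ⟨f, hf⟩
      -- Writing `f = T h` gives the measure of `f` the density `x²`, which absorbs the singularity:
      -- `x² (x⁻¹ - 1)² = (1 - x)²`.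
      set h : H := f + A ⟨f, hf⟩
      rw [← (show T h = f from hf'), hν, lintegral_withDensity_eq_lintegral_mul _ hm2
        (by fun_prop)]
      refine lt_of_le_of_lt (lintegral_mono_ae ?_) (integrable_boundedMeasure hsa h
        (g := fun x => (1 - x) ^ 2) (by fun_prop)).lintegral_lt_top
      filter_upwards [ae_pos_boundedMeasure hT hd h] with x hx
      rw [Pi.mul_apply, ← ENNReal.ofReal_mul (sq_nonneg _)]
      refine ENNReal.ofReal_le_ofReal (le_of_eq ?_)
      field_simp
    · intro hf
      refine mem_domain_of_lintegral_lt_top hA hT hd hTA ?_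
      have h1 : ∀ x : ℝ, ENNReal.ofReal ((x⁻¹) ^ 2) ≤
          2 * ENNReal.ofReal ((x⁻¹ - 1) ^ 2) + 2 := fun x => by
        rw [← ENNReal.ofReal_ofNat 2, ← ENNReal.ofReal_mul zero_le_two,
          ← ENNReal.ofReal_add (by positivity) zero_le_two]
        refine ENNReal.ofReal_le_ofReal ?_
        nlinarith [sq_nonneg (x⁻¹ - 2)]
      refine lt_of_le_of_lt (lintegral_mono h1) ?_
      rw [lintegral_add_right _ measurable_const, lintegral_const_mul _ (by fun_prop),
        lintegral_const]
      exact ENNReal.add_lt_top.2 ⟨ENNReal.mul_lt_top (by simp) hf,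
        ENNReal.mul_lt_top (by simp) (measure_lt_top _ _)⟩
  · have hreal : ((⟪(f : H), A f⟫_ℂ).re : ℂ) = ⟪(f : H), A f⟫_ℂ := by
      rw [← Complex.conj_eq_iff_re, inner_conj_symm]
      exact inner_symm_of_isSelfAdjoint hA f f
    rw [← hreal]
    congr 1
    have hf' := hTA f
    set h : H := f + A f with hh
    have hAf : A f = h - T h := by rw [hf', hh, add_sub_cancel_left]
    rw [hE, integral_map hφ.aemeasurable (by fun_prop), hAf, ← hf', hν,
      integral_withDensity_eq_integral_toReal_smul hm2 (Eventually.of_forall fun _ =>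
        ENNReal.ofReal_lt_top)]
    -- Matches the integrand on the other side, since `x² (x⁻¹ - 1) = x (1 - x)`.
    have h1 : ⟪T h, h - T h⟫_ℂ = ⟪h, cfc (fun x : ℝ => x * (1 - x)) T h⟫_ℂ := by
      rw [cfc_mul_apply continuous_id' (by fun_prop), hid, hsymm,
        cfc_sub (fun _ => (1 : ℝ)) (fun x => x) T continuousOn_const (continuousOn_id' _),
        cfc_const_one ℝ T, hid, sub_apply, one_apply_eq_self]
    rw [h1, ← integral_boundedMeasure hsa h (by fun_prop)]
    refine integral_congr_ae ?_
    filter_upwards [ae_pos_boundedMeasure hT hd h] with x hx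
    rw [ENNReal.toReal_ofReal (sq_nonneg _), smul_eq_mul]
    field_simp

end Resolution

/-! ### Absence of negative spectrum and Chebyshev's inequality -/

section Positive

variable {H : Type*} [NormedAddCommGroup H] [InnerProductSpace ℂ H] [CompleteSpace H]
  {A : H →ₗ.[ℂ] H}

theorem isResolutionOf_spectralFamily (hA : IsSelfAdjoint A) (hpos : IsPositiveOp A) :
    (spectralFamily A).IsResolutionOf A :=
  Classical.epsilon_spec (exists_isResolutionOf hA hpos)

theorem SpectralFamily.proj_proj (E : SpectralFamily H) {s t : ℝ} (h : s ≤ t) (f : H) :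
    E.proj s (E.proj t f) = E.proj s f := by
  conv_rhs => rw [← E.proj_mul s t h]
  rfl

theorem SpectralFamily.proj_proj' (E : SpectralFamily H) {s t : ℝ} (h : s ≤ t) (f : H) :
    E.proj t (E.proj s f) = E.proj s f := by
  have h1 := congrArg star (E.proj_mul s t h)
  rw [star_mul, (E.isProj s).isSelfAdjoint.star_eq, (E.isProj t).isSelfAdjoint.star_eq] at h1
  conv_rhs => rw [← h1]
  rfl

/-- The difference `g` has its spectral measure in `[s, t[`, which is bounded, so `g` is in the
domain and `0 ≤ ⟨g, A g⟩ ≤ t ‖g‖²` with `t < 0`. -/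
theorem SpectralFamily.IsResolutionOf.proj_eq_proj {E : SpectralFamily H}
    (hE : E.IsResolutionOf A) (hpos : IsPositiveOp A) {s t : ℝ} (hst : s ≤ t) (ht : t < 0) (f : H) :
    E.proj t f = E.proj s f := by
  set g := E.proj t f - E.proj s f with hg
  have h1 : E.scalarMeasure g (Set.Iio s) = 0 := by
    rw [E.scalarMeasure_Iio, hg, map_sub, E.proj_proj hst, E.proj_proj le_rfl, sub_self]
    simp
  have h2 : E.scalarMeasure g (Set.Ici t) = 0 := by
    rw [← Set.compl_Iio, measure_compl measurableSet_Iio (measure_ne_top _ _),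
      E.scalarMeasure_univ, E.scalarMeasure_Iio, hg, map_sub, E.proj_proj le_rfl,
      E.proj_proj' hst, tsub_self]
  have hmem : ∀ᵐ r ∂E.scalarMeasure g, s ≤ r ∧ r < t := by
    have h1' := measure_eq_zero_iff_ae_notMem.1 h1
    have h2' := measure_eq_zero_iff_ae_notMem.1 h2
    filter_upwards [h1', h2'] with r hr1 hr2
    exact ⟨not_lt.1 hr1, not_le.1 hr2⟩
  have hint : Integrable (fun r : ℝ => r) (E.scalarMeasure g) := by
    refine Integrable.of_bound (by fun_prop) (-s) ?_
    filter_upwards [hmem] with r hr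
    rw [Real.norm_of_nonpos (by linarith)]
    linarith
  have hdom : g ∈ A.domain := by
    rw [hE.mem_domain_iff]
    refine lt_of_le_of_lt (lintegral_mono_ae (g := fun _ => ENNReal.ofReal (s ^ 2)) ?_) ?_
    · filter_upwards [hmem] with r hr
      refine ENNReal.ofReal_le_ofReal ?_
      nlinarith
    · rw [lintegral_const]
      exact ENNReal.mul_lt_top ENNReal.ofReal_lt_top (measure_lt_top _ _)
  have h3 := hpos ⟨g, hdom⟩
  rw [hE.inner_apply ⟨g, hdom⟩, Complex.ofReal_re] at h3
  have h4 : ∫ r, r ∂E.scalarMeasure g ≤ ∫ _, t ∂E.scalarMeasure g := by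
    refine integral_mono_ae hint (integrable_const _) ?_
    filter_upwards [hmem] with r hr using hr.2.le
  rw [integral_const, measureReal_def, E.scalarMeasure_univ, ENNReal.toReal_ofReal (sq_nonneg _),
    smul_eq_mul] at h4
  have h5 : ‖g‖ ^ 2 = 0 := by
    by_contra hne
    have : 0 < ‖g‖ ^ 2 := lt_of_le_of_ne (sq_nonneg _) (Ne.symm hne)
    have h6 := mul_neg_of_pos_of_neg this ht
    exact absurd (h3.trans h4) (not_le.2 h6)
  exact sub_eq_zero.1 (norm_eq_zero.1 ((pow_eq_zero_iff two_ne_zero).1 h5))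

theorem SpectralFamily.IsResolutionOf.proj_zero {E : SpectralFamily H}
    (hE : E.IsResolutionOf A) (hpos : IsPositiveOp A) (f : H) : E.proj 0 f = 0 := by
  have h1 : ∀ t < 0, E.proj t f = 0 := fun t ht => by
    refine tendsto_nhds_unique (tendsto_const_nhds.congr' ?_) (E.tendsto_bot f)
    filter_upwards [eventually_le_atBot t] with s hs using hE.proj_eq_proj hpos hs ht f
  refine tendsto_nhds_unique (E.left_cont f 0) (tendsto_const_nhds.congr' ?_)
  filter_upwards [self_mem_nhdsWithin] with t ht using (h1 t ht).symm

theorem energyNeg_eq_zero (hA : IsSelfAdjoint A) (hpos : IsPositiveOp A) (f : H) :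
    energyNeg A f = 0 := by
  have h : (spectralFamily A).scalarMeasure f (Set.Iio 0) = 0 := by
    rw [SpectralFamily.scalarMeasure_Iio,
      (isResolutionOf_spectralFamily hA hpos).proj_zero hpos f]
    simp
  rw [energyNeg, lintegral_eq_zero_iff (by fun_prop)]
  filter_upwards [measure_eq_zero_iff_ae_notMem.1 h] with t ht
  exact ENNReal.ofReal_of_nonpos (neg_nonpos.2 (not_lt.1 ht))

/-- Chebyshev's inequality for the spectral measure. -/
theorem one_le_two_mul_scalarMeasure {lam : ℝ} (hlam : 0 < lam) {f : H} (hf : ‖f‖ = 1)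
    (hE : energyPos A f ≤ ENNReal.ofReal lam) :
    1 ≤ 2 * (spectralFamily A).scalarMeasure f (Set.Iio (2 * lam)) := by
  set m := (spectralFamily A).scalarMeasure f with hm
  have h1 : ENNReal.ofReal (2 * lam) * m (Set.Ici (2 * lam)) ≤ ENNReal.ofReal lam := by
    refine le_trans ?_ hE
    refine le_trans ?_ (mul_meas_ge_le_lintegral ENNReal.measurable_ofReal
      (ENNReal.ofReal (2 * lam)))
    gcongr
    exact fun x hx => ENNReal.ofReal_le_ofReal hx
  have h2 : m (Set.Iio (2 * lam)) + m (Set.Ici (2 * lam)) = 1 := by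
    rw [← Set.compl_Iio, measure_add_measure_compl measurableSet_Iio, hm,
      SpectralFamily.scalarMeasure_univ, hf]
    simp
  have h3 : 2 * m (Set.Ici (2 * lam)) ≤ 1 := by
    rw [ENNReal.ofReal_mul zero_le_two, ENNReal.ofReal_ofNat, mul_right_comm] at h1
    have h0 : ENNReal.ofReal lam ≠ 0 := by simpa using hlam
    refine (ENNReal.mul_le_mul_iff_left h0 ENNReal.ofReal_ne_top).1 ?_
    rwa [one_mul]
  have h4 : (1 : ℝ≥0∞) + 1 ≤ 2 * m (Set.Iio (2 * lam)) + 1 := by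
    calc (1 : ℝ≥0∞) + 1 = 2 * (m (Set.Iio (2 * lam)) + m (Set.Ici (2 * lam))) := by
          rw [h2, mul_one, one_add_one_eq_two]
      _ = 2 * m (Set.Iio (2 * lam)) + 2 * m (Set.Ici (2 * lam)) := mul_add _ _ _
      _ ≤ _ := by gcongr
  exact (ENNReal.add_le_add_iff_right ENNReal.one_ne_top).1 h4

end Positive

section Main

variable {X : Type*} [MeasurableSpace X] {μ : Measure X}
  {V : Type*} [NormedAddCommGroup V] [InnerProductSpace ℂ V] [CompleteSpace V]
  {A : Lp V 2 μ →ₗ.[ℂ] Lp V 2 μ} {Ω : Set X} {lam : ℝ}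

/-- Sums Chebyshev's inequality over the test system. At `lam = 0` the left side may count null
vectors of `A`, while `Π_0 = 0` on the right. -/
theorem natCast_le_two_mul_specMeasure (hA : IsSelfAdjoint A) (hpos : IsPositiveOp A)
    (hΩ : MeasurableSet Ω) (hlam : lam ≠ 0) {n : ℕ} (hn : (n : ℕ∞) ≤ dirichletCount A Ω lam) :
    (n : ℝ≥0∞) ≤ 2 * specMeasure A hΩ (2 * lam) := by
  obtain ⟨e, he, hs, hE⟩ := exists_orthonormal_of_le_dirichletCount A hn
  have hE' : ∀ k, energyPos A (e k) + ENNReal.ofReal (-lam) ≤ ENNReal.ofReal lam := fun k => by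
    have h := coe_sub_coe_le_coe_iff.1 (hE k).2
    rwa [energyNeg_eq_zero hA hpos, zero_add] at h
  -- For `lam < 0` the energy is nonnegative, so no unit test vector exists and `n = 0`.
  rcases hlam.lt_or_gt with hl | hl
  · rcases Nat.eq_zero_or_pos n with rfl | hn0
    · simp
    · have h := hE' ⟨0, hn0⟩
      rw [ENNReal.ofReal_of_nonpos hl.le, nonpos_iff_eq_zero, add_eq_zero,
        ENNReal.ofReal_eq_zero] at h
      linarith [h.2]
  · calc (n : ℝ≥0∞) = ∑ _k : Fin n, 1 := by simp
      _ ≤ ∑ k, 2 * (spectralFamily A).scalarMeasure (e k) (Set.Iio (2 * lam)) :=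
        Finset.sum_le_sum fun k _ => one_le_two_mul_scalarMeasure hl (he.1 k)
          (le_self_add.trans (hE' k))
      _ = 2 * ∑ k, (spectralFamily A).scalarMeasure (e k) (Set.Iio (2 * lam)) :=
        (Finset.mul_sum _ _ _).symm
      _ ≤ _ := by
        gcongr
        exact sum_scalarMeasure_Iio_le hΩ he hs _

theorem dirichletCount_le_two_mul_specMeasure (hA : IsSelfAdjoint A) (hpos : IsPositiveOp A)
    (hΩ : MeasurableSet Ω) (hlam : lam ≠ 0) :
    (dirichletCount A Ω lam : ℝ≥0∞) ≤ 2 * specMeasure A hΩ (2 * lam) := by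
  rcases eq_or_ne (dirichletCount A Ω lam) ⊤ with h | h
  · refine le_of_forall_lt fun c hc => ?_
    obtain ⟨n, hn⟩ := ENNReal.exists_nat_gt hc.ne_top
    exact hn.trans_le (natCast_le_two_mul_specMeasure hA hpos hΩ hlam (h ▸ le_top))
  · obtain ⟨n, hn⟩ := ENat.ne_top_iff_exists.1 h
    rw [← hn, ENat.toENNReal_coe]
    exact natCast_le_two_mul_specMeasure hA hpos hΩ hlam hn.le

end Main

end DirichletCounting

end

theorem mainTheorem7 {X : Type*} [MeasurableSpace X] (μ : Measure X) [SigmaFinite μ]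
    {V : Type*} [NormedAddCommGroup V] [InnerProductSpace ℂ V] [CompleteSpace V]
    [TopologicalSpace.SeparableSpace V]
    (A : Lp V 2 μ →ₗ.[ℂ] Lp V 2 μ) (hA : IsSelfAdjoint A)
    (Ω : Set X) (hΩ : MeasurableSet Ω) :
    (∀ lam : ℝ,
      (∀ y : ℝ≥0∞, y ≠ ⊤ → y ≤ (DirichletCounting.dirichletCount A Ω lam : ℝ≥0∞) →
        DirichletCounting.phiPos (DirichletCounting.specMeasure A hΩ) y < ⊤) ∧
      DirichletCounting.phi (DirichletCounting.specMeasure A hΩ)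
          (DirichletCounting.dirichletCount A Ω lam : ℝ≥0∞) ≤
        (lam : EReal) * ((DirichletCounting.dirichletCount A Ω lam : ℝ≥0∞) : EReal)) ∧
    (DirichletCounting.IsPositiveOp A → ∀ lam : ℝ, lam ≠ 0 →
      (DirichletCounting.dirichletCount A Ω lam : ℝ≥0∞) ≤
        2 * DirichletCounting.specMeasure A hΩ (2 * lam)) :=
  ⟨fun lam => ⟨fun _ hy hyN => DirichletCounting.phiPos_lt_top hΩ hy hyN,
    DirichletCounting.phi_dirichletCount_le A hΩ lam⟩,
    fun hpos _ hlam => DirichletCounting.dirichletCount_le_two_mul_specMeasure hA hpos hΩ hlam⟩
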